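/- Let $\mathcal Q_2$ be the universal unital C*-algebra generated by a unitary $U$ and an isometry $S_2$ with $S_2U=U^2S_2$ and $S_2S_2^*+US_2S_2^*U^*=1$. Let $\mathcal O_2$ be the Cuntz algebra, the universal unital C*-algebra generated by two isometries $S_1,S_2$ with $S_1S_1^*+S_2S_2^*=1$, mapped into $\mathcal Q_2$ by the embedding $S_1\mapsto US_2$, $S_2\mapsto S_2$. Let $\rho_c$ be the canonical representation of $\mathcal Q_2$ on $\ell^2(\mathbb Z)$, $\rho_c(U)e_k=e_{k+1}$, $\rho_c(S_2)e_k=e_{2k}$, and let $\pi_+$ and $\pi_-$ be the restrictions of $\rho_c|_{\mathcal O_2}$ to its invariant subspaces $\mathcal H_+=\overline{\mathrm{span}}\{e_k:k\ge 0\}$ and $\mathcal H_-=\overline{\mathrm{span}}\{e_k:k<0\}$. For $i\in\{1,2\}$, a representation $\pi$ of $\mathcal O_2$ on a Hilbert space $\mathcal H$ is said to be of type $P(i)$ if there are an orthonormal basis $(e_n)_{n\in\mathbb N}$ of $\mathcal H$ and injections $\sigma_1,\sigma_2:\mathbb N\to\mathbb N$, whose ranges are disjoint with union $\mathbb N$,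 such that $\pi(S_j)e_n=e_{\sigma_j(n)}$ for $j=1,2$ and all $n$, and if some basis vector $e_n$ is cyclic for $\pi$ and satisfies $\pi(S_i)e_n=e_n$. Theorem. The representation $\pi_-$ is of type $P(1)$ and $\pi_+$ is of type $P(2)$. If $\pi:\mathcal O_2\to\mathcal B(\mathcal H)$ is any representation of type $P(1)$ or $P(2)$ and $x\in\mathcal H$ is a unit vector, then the vector state $\omega_x(T)=(\pi(T)x,x)$, $T\in\mathcal O_2$, is a pure state of $\mathcal O_2$ and has the unique extension property: there is exactly one pure state $\Omega$ of $\mathcal Q_2$ whose restriction to $\mathcal O_2$ is $\omega_x$. -/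

import Mathlib

open scoped InnerProductSpace ComplexOrder

noncomputable section

/-! ### The free unital `*`-algebra -/

/-- The free unital complex `*`-algebra on `X`: the free algebra on the letters `x` (`Sum.inl x`)
and the formal adjoints `x*` (`Sum.inr x`). -/
def FreeStarAlg (X : Type) : Type := FreeAlgebra ℂ (X ⊕ X)

/-- The opposite of a complex algebra, with conjugated scalar multiplication. -/
def ConjOp (A : Type) : Type := Aᵐᵒᵖ

instance (A : Type) [Ring A] : Ring (ConjOp A) := inferInstanceAs (Ring Aᵐᵒᵖ)

instance (A : Type) [Ring A] [Algebra ℂ A] : Algebra ℂ (ConjOp A) :=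
  RingHom.toAlgebra' (((algebraMap ℂ Aᵐᵒᵖ).comp (starRingEnd ℂ) : ℂ →+* Aᵐᵒᵖ))
    (fun c x => Algebra.commutes (A := Aᵐᵒᵖ) (starRingEnd ℂ c) x)

namespace FreeStarAlg

variable {X : Type}

instance : Ring (FreeStarAlg X) := inferInstanceAs (Ring (FreeAlgebra ℂ (X ⊕ X)))

instance : Algebra ℂ (FreeStarAlg X) := inferInstanceAs (Algebra ℂ (FreeAlgebra ℂ (X ⊕ X)))

/-- The letter `x`. -/
def gen (x : X) : FreeStarAlg X := FreeAlgebra.ι ℂ (Sum.inl x : X ⊕ X)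

/-- The letter `x*`. -/
def genStar (x : X) : FreeStarAlg X := FreeAlgebra.ι ℂ (Sum.inr x : X ⊕ X)

/-- The algebra homomorphism determined by values on the letters `x` and `x*`. -/
def liftAlg {B : Type*} [Ring B] [Algebra ℂ B] (f g : X → B) : FreeStarAlg X →ₐ[ℂ] B :=
  FreeAlgebra.lift ℂ (Sum.elim f g)

@[simp] theorem liftAlg_gen {B : Type*} [Ring B] [Algebra ℂ B] (f g : X → B) (x : X) :
    liftAlg f g (gen x) = f x := FreeAlgebra.lift_ι_apply _ _

@[simp] theorem liftAlg_genStar {B : Type*} [Ring B] [Algebra ℂ B] (f g : X → B) (x : X) :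
    liftAlg f g (genStar x) = g x := FreeAlgebra.lift_ι_apply _ _

theorem induct {P : FreeStarAlg X → Prop} (h₀ : ∀ c : ℂ, P (algebraMap ℂ _ c))
    (h₁ : ∀ x, P (gen x)) (h₂ : ∀ x, P (genStar x)) (hm : ∀ a b, P a → P b → P (a * b))
    (ha : ∀ a b, P a → P b → P (a + b)) (a : FreeStarAlg X) : P a :=
  FreeAlgebra.induction (R := ℂ) (X := X ⊕ X) (motive := P) h₀
    (fun y => y.casesOn h₁ h₂) hm ha a

/-- The algebra homomorphism to the conjugate opposite algebra that exchanges `x` and `x*`. -/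
def starAux : FreeStarAlg X →ₐ[ℂ] ConjOp (FreeStarAlg X) :=
  liftAlg (fun x => (MulOpposite.op (genStar x) : (FreeStarAlg X)ᵐᵒᵖ))
    (fun x => (MulOpposite.op (gen x) : (FreeStarAlg X)ᵐᵒᵖ))

/-- The conjugate-linear anti-multiplicative involution exchanging `x` and `x*`. -/
instance : Star (FreeStarAlg X) :=
  ⟨fun a => MulOpposite.unop (starAux a : (FreeStarAlg X)ᵐᵒᵖ)⟩

@[simp] theorem star_gen (x : X) : star (gen x) = genStar x :=
  congrArg MulOpposite.unop (liftAlg_gen (B := ConjOp (FreeStarAlg X)) _ _ x)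

@[simp] theorem star_genStar (x : X) : star (genStar x) = gen x :=
  congrArg MulOpposite.unop (liftAlg_genStar (B := ConjOp (FreeStarAlg X)) _ _ x)

theorem star_add' (a b : FreeStarAlg X) : star (a + b) = star a + star b :=
  congrArg MulOpposite.unop (map_add starAux a b)

theorem star_mul' (a b : FreeStarAlg X) : star (a * b) = star b * star a :=
  congrArg MulOpposite.unop (map_mul starAux a b)

theorem star_algebraMap' (c : ℂ) :
    star (algebraMap ℂ (FreeStarAlg X) c) = algebraMap ℂ _ (star c) :=
  congrArg MulOpposite.unop (starAux.commutes c)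

instance : StarRing (FreeStarAlg X) where
  star_involutive a := by
    induction a using induct with
    | h₀ c => simp [star_algebraMap']
    | h₁ x => simp
    | h₂ x => simp
    | hm a b h h' => rw [star_mul', star_mul', h, h']
    | ha a b h h' => rw [star_add', star_add', h, h']
  star_mul := star_mul'
  star_add := star_add'

instance : StarModule ℂ (FreeStarAlg X) where
  star_smul c a := by
    rw [Algebra.smul_def, star_mul, star_algebraMap', Algebra.smul_def, Algebra.commutes]

/-- Evaluation of `*`-polynomials at a family of elements of a `*`-algebra. -/
def eval {B : Type*} [Ring B] [StarRing B] [Algebra ℂ B] [StarModule ℂ B] (b : X → B) :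
    FreeStarAlg X →⋆ₐ[ℂ] B :=
  { liftAlg b (fun x => star (b x)) with
    map_star' := fun a => by
      change liftAlg b (fun x => star (b x)) (star a) = star (liftAlg b (fun x => star (b x)) a)
      induction a using induct with
      | h₀ c => rw [star_algebraMap', AlgHom.commutes, AlgHom.commutes, algebraMap_star_comm]
      | h₁ x => simp
      | h₂ x => simp
      | hm a b h h' => rw [star_mul, map_mul, map_mul, star_mul, h, h']
      | ha a b h h' => rw [star_add, map_add, map_add, star_add, h, h'] }

@[simp] theorem eval_gen {B : Type*} [Ring B] [StarRing B] [Algebra ℂ B] [StarModule ℂ B]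
    (b : X → B) (x : X) : eval b (gen x) = b x := liftAlg_gen _ _ x

end FreeStarAlg

/-! ### Universal C*-algebras -/

/-- A C*-seminorm on the free `*`-algebra. -/
structure IsCStarSeminorm {X : Type} (q : Seminorm ℂ (FreeStarAlg X)) : Prop where
  mul_le : ∀ a b, q (a * b) ≤ q a * q b
  star_mul_self : ∀ a, q (star a * a) = q a ^ 2

/-- The C*-seminorms on the free `*`-algebra that vanish on the relations `R` and for which the
generators are contractions. (If the relations force the generators to be isometries or unitaries,
the last condition holds automatically.) -/
def admissibleSeminorms {X : Type} (R : Set (FreeStarAlg X)) :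
    Set (Seminorm ℂ (FreeStarAlg X)) :=
  {q | IsCStarSeminorm q ∧ (∀ x, q (FreeStarAlg.gen x) ≤ 1) ∧ ∀ r ∈ R, q r = 0}

namespace admissibleSeminorms

open FreeStarAlg

variable {X : Type} {R : Set (FreeStarAlg X)}

theorem map_one_le {q : Seminorm ℂ (FreeStarAlg X)} (hq : IsCStarSeminorm q) : q 1 ≤ 1 := by
  have h := hq.star_mul_self 1
  rw [star_one, one_mul] at h
  nlinarith [apply_nonneg q 1]

theorem map_star_le {q : Seminorm ℂ (FreeStarAlg X)} (hq : IsCStarSeminorm q)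
    (a : FreeStarAlg X) : q a ≤ q (star a) := by
  have h := hq.star_mul_self a
  have h' := hq.mul_le (star a) a
  by_contra! hlt
  have : 0 < q a := lt_of_le_of_lt (apply_nonneg q (star a)) hlt
  nlinarith

theorem bdd (R : Set (FreeStarAlg X)) (a : FreeStarAlg X) :
    ∃ C : ℝ, ∀ q ∈ admissibleSeminorms R, q a ≤ C := by
  induction a using FreeStarAlg.induct with
  | h₀ c =>
    refine ⟨‖c‖, fun q hq => ?_⟩
    rw [Algebra.algebraMap_eq_smul_one, map_smul_eq_mul]
    exact mul_le_of_le_one_right (norm_nonneg _) (map_one_le hq.1)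
  | h₁ x => exact ⟨1, fun q hq => hq.2.1 x⟩
  | h₂ x =>
    refine ⟨1, fun q hq => (map_star_le hq.1 _).trans ?_⟩
    rw [star_genStar]
    exact hq.2.1 x
  | hm a b h h' =>
    obtain ⟨C, hC⟩ := h
    obtain ⟨D, hD⟩ := h'
    refine ⟨C * D, fun q hq => (hq.1.mul_le a b).trans ?_⟩
    exact mul_le_mul (hC q hq) (hD q hq) (apply_nonneg _ _)
      ((apply_nonneg q a).trans (hC q hq))
  | ha a b h h' =>
    obtain ⟨C, hC⟩ := h
    obtain ⟨D, hD⟩ := h'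
    exact ⟨C + D, fun q hq => (map_add_le_add q a b).trans (add_le_add (hC q hq) (hD q hq))⟩

theorem zero_mem : (0 : Seminorm ℂ (FreeStarAlg X)) ∈ admissibleSeminorms R :=
  ⟨⟨fun a b => by simp, fun a => by simp⟩, fun x => by simp, fun r _ => by simp⟩

instance : Nonempty (admissibleSeminorms R) := ⟨⟨0, zero_mem⟩⟩

/-- The largest admissible C*-seminorm. -/
def univNorm (R : Set (FreeStarAlg X)) (a : FreeStarAlg X) : ℝ :=
  ⨆ q : admissibleSeminorms R, q.1 a

theorem le_univNorm {q : Seminorm ℂ (FreeStarAlg X)} (hq : q ∈ admissibleSeminorms R)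
    (a : FreeStarAlg X) : q a ≤ univNorm R a :=
  le_ciSup (f := fun q : admissibleSeminorms R => q.1 a)
    (let ⟨C, hC⟩ := bdd R a; ⟨C, by rintro _ ⟨q, rfl⟩; exact hC q.1 q.2⟩) ⟨q, hq⟩

theorem univNorm_le {a : FreeStarAlg X} {C : ℝ} (h : ∀ q ∈ admissibleSeminorms R, q a ≤ C) :
    univNorm R a ≤ C := ciSup_le fun q => h q.1 q.2

theorem univNorm_nonneg (a : FreeStarAlg X) : 0 ≤ univNorm R a :=
  (apply_nonneg (0 : Seminorm ℂ (FreeStarAlg X)) a).trans (le_univNorm zero_mem a)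

theorem univNorm_smul_le (c : ℂ) (a : FreeStarAlg X) :
    univNorm R (c • a) ≤ ‖c‖ * univNorm R a :=
  univNorm_le fun q hq => by
    rw [map_smul_eq_mul]
    exact mul_le_mul_of_nonneg_left (le_univNorm hq a) (norm_nonneg _)

theorem univNorm_star_mul_self (a : FreeStarAlg X) :
    univNorm R a * univNorm R a ≤ univNorm R (star a * a) := by
  have h0 := univNorm_nonneg (R := R) (star a * a)
  have : univNorm R a ≤ √(univNorm R (star a * a)) := univNorm_le fun q hq => by
    refine Real.le_sqrt_of_sq_le ?_
    rw [← hq.1.star_mul_self]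
    exact le_univNorm hq _
  calc _ ≤ √(univNorm R (star a * a)) * √(univNorm R (star a * a)) :=
        mul_self_le_mul_self (univNorm_nonneg a) this
    _ = _ := Real.mul_self_sqrt h0

theorem univNorm_star (a : FreeStarAlg X) : univNorm R (star a) = univNorm R a := by
  have key : ∀ a : FreeStarAlg X, univNorm R a ≤ univNorm R (star a) := fun a =>
    univNorm_le fun q hq => (map_star_le hq.1 a).trans (le_univNorm hq _)
  exact le_antisymm (by simpa using key (star a)) (key a)

/-- The largest admissible C*-seminorm as a ring seminorm. -/
def univRingSeminorm (R : Set (FreeStarAlg X)) : RingSeminorm (FreeStarAlg X) where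
  toFun := univNorm R
  map_zero' := le_antisymm (univNorm_le fun q _ => (map_zero q).le) (univNorm_nonneg 0)
  add_le' a b := univNorm_le fun q hq =>
    (map_add_le_add q a b).trans (add_le_add (le_univNorm hq a) (le_univNorm hq b))
  neg' a := by simp only [univNorm, map_neg_eq_map]
  mul_le' a b := univNorm_le fun q hq => (hq.1.mul_le a b).trans
    (mul_le_mul (le_univNorm hq a) (le_univNorm hq b) (apply_nonneg _ _) (univNorm_nonneg a))

end admissibleSeminorms

open admissibleSeminorms

/-- The free `*`-algebra, equipped with the largest admissible C*-seminorm. -/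
def PreUnivCStar {X : Type} (_R : Set (FreeStarAlg X)) : Type := FreeStarAlg X

section

variable {X : Type} {R : Set (FreeStarAlg X)}

instance : SeminormedRing (PreUnivCStar R) := (univRingSeminorm R).toSeminormedRing

instance : StarRing (PreUnivCStar R) := inferInstanceAs (StarRing (FreeStarAlg X))

instance : NormedAlgebra ℂ (PreUnivCStar R) where
  __ := (inferInstanceAs (Algebra ℂ (FreeStarAlg X)) : Algebra ℂ (PreUnivCStar R))
  norm_smul_le c a := univNorm_smul_le (R := R) c a

instance : StarModule ℂ (PreUnivCStar R) := inferInstanceAs (StarModule ℂ (FreeStarAlg X))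

instance : NormedStarGroup (PreUnivCStar R) := ⟨fun a => (univNorm_star (R := R) a).le⟩

end

/-- The universal unital C*-algebra generated by contractions indexed by `X` subject to the
relations `r = 0`, `r ∈ R`: the Hausdorff completion of the free `*`-algebra for the largest
C*-seminorm compatible with the relations. -/
def UnivCStar {X : Type} (R : Set (FreeStarAlg X)) : Type :=
  UniformSpace.Completion (PreUnivCStar R)

namespace UnivCStar

open UniformSpace

variable {X : Type} {R : Set (FreeStarAlg X)}

instance : NormedRing (UnivCStar R) :=
  inferInstanceAs (NormedRing (Completion (PreUnivCStar R)))

instance : CompleteSpace (UnivCStar R) :=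
  inferInstanceAs (CompleteSpace (Completion (PreUnivCStar R)))

instance : NormedAlgebra ℂ (UnivCStar R) where
  __ := (inferInstanceAs (Algebra ℂ (Completion (PreUnivCStar R))) : Algebra ℂ (UnivCStar R))
  norm_smul_le := norm_smul_le (α := ℂ) (β := Completion (PreUnivCStar R))

/-- The class of a `*`-polynomial in the universal C*-algebra. -/
def mk (R : Set (FreeStarAlg X)) (a : FreeStarAlg X) : UnivCStar R :=
  Completion.coe' (α := PreUnivCStar R) a

theorem denseRange_mk : DenseRange (mk R) :=
  Completion.denseRange_coe (α := PreUnivCStar R)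

theorem norm_mk (a : FreeStarAlg X) : ‖mk R a‖ = univNorm R a :=
  Completion.norm_coe (E := PreUnivCStar R) a

theorem mk_add (a b : FreeStarAlg X) : mk R (a + b) = mk R a + mk R b :=
  Completion.coe_add (α := PreUnivCStar R) a b

theorem mk_mul (a b : FreeStarAlg X) : mk R (a * b) = mk R a * mk R b :=
  Completion.coe_mul (α := PreUnivCStar R) a b

theorem mk_zero : mk R 0 = 0 := rfl

theorem mk_algebraMap (c : ℂ) : mk R (algebraMap ℂ _ c) = algebraMap ℂ (UnivCStar R) c := rfl

instance : Star (UnivCStar R) :=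
  ⟨Completion.map (star : PreUnivCStar R → PreUnivCStar R)⟩

theorem mk_star (a : FreeStarAlg X) : mk R (star a) = star (mk R a) :=
  (Completion.map_coe (f := (star : PreUnivCStar R → PreUnivCStar R))
    (starNormedAddGroupHom (E := PreUnivCStar R)).uniformContinuous a).symm

theorem continuous_star' : Continuous (star : UnivCStar R → UnivCStar R) :=
  Completion.continuous_map

theorem induct {P : UnivCStar R → Prop} (hc : IsClosed {a | P a}) (h : ∀ a, P (mk R a))
    (a : UnivCStar R) : P a := Completion.induction_on (α := PreUnivCStar R) a hc h

instance : StarRing (UnivCStar R) where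
  star_involutive a := by
    induction a using induct with
    | hc => exact isClosed_eq (continuous_star'.comp continuous_star') continuous_id
    | h a => rw [← mk_star, ← mk_star, star_star]
  star_mul a b := by
    induction a using induct with
    | hc =>
      exact isClosed_eq (continuous_star'.comp (continuous_id.mul continuous_const))
        (continuous_const.mul continuous_star')
    | h a =>
      induction b using induct with
      | hc =>
        exact isClosed_eq (continuous_star'.comp (continuous_const.mul continuous_id))
          (continuous_star'.mul continuous_const)
      | h b => rw [← mk_mul, ← mk_star, ← mk_star, ← mk_star, ← mk_mul, star_mul]
  star_add a b := by
    induction a using induct with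
    | hc =>
      exact isClosed_eq (continuous_star'.comp (continuous_id.add continuous_const))
        (continuous_star'.add continuous_const)
    | h a =>
      induction b using induct with
      | hc =>
        exact isClosed_eq (continuous_star'.comp (continuous_const.add continuous_id))
          (continuous_const.add continuous_star')
      | h b => rw [← mk_add, ← mk_star, ← mk_star, ← mk_star, ← mk_add, star_add]

instance : StarModule ℂ (UnivCStar R) where
  star_smul c a := by
    induction a using induct with
    | hc =>
      exact isClosed_eq (continuous_star'.comp (continuous_id.const_smul c))
        (continuous_star'.const_smul (star c))
    | h a =>
      rw [Algebra.smul_def, Algebra.smul_def, ← mk_algebraMap, ← mk_algebraMap, ← mk_mul,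
        ← mk_star, ← mk_star, ← mk_mul, star_mul, FreeStarAlg.star_algebraMap', Algebra.commutes]

instance : CStarRing (UnivCStar R) where
  norm_mul_self_le a := by
    induction a using induct with
    | hc =>
      exact isClosed_le (continuous_norm.mul continuous_norm)
        (continuous_norm.comp (continuous_star'.mul continuous_id))
    | h a => rw [← mk_star, ← mk_mul, norm_mk, norm_mk]; exact univNorm_star_mul_self a

instance : CStarAlgebra (UnivCStar R) where

/-- The quotient map from `*`-polynomials. -/
def mkHom (R : Set (FreeStarAlg X)) : FreeStarAlg X →⋆ₐ[ℂ] UnivCStar R where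
  toFun := mk R
  map_one' := rfl
  map_mul' := mk_mul
  map_zero' := mk_zero
  map_add' := mk_add
  commutes' := mk_algebraMap
  map_star' := mk_star

/-- The canonical generators. -/
def gen (R : Set (FreeStarAlg X)) (x : X) : UnivCStar R := mkHom R (FreeStarAlg.gen x)

theorem mkHom_eq_zero {r : FreeStarAlg X} (hr : r ∈ R) : mkHom R r = 0 := by
  rw [← norm_eq_zero]
  exact (norm_mk (R := R) r).trans
    (le_antisymm (univNorm_le fun q hq => (hq.2.2 r hr).le) (univNorm_nonneg r))

section lift

variable {B : Type*} [CStarAlgebra B]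

theorem norm_eval_le (b : X → B) (hb : ∀ x, ‖b x‖ ≤ 1)
    (hR : ∀ r ∈ R, FreeStarAlg.eval b r = 0) (a : FreeStarAlg X) :
    ‖FreeStarAlg.eval b a‖ ≤ univNorm R a := by
  let q : Seminorm ℂ (FreeStarAlg X) :=
    (normSeminorm ℂ B).comp (FreeStarAlg.eval b).toAlgHom.toLinearMap
  have hq : ∀ a, q a = ‖FreeStarAlg.eval b a‖ := fun _ => rfl
  have : q ∈ admissibleSeminorms R := by
    refine ⟨⟨fun a b => ?_, fun a => ?_⟩, fun x => ?_, fun r hr => ?_⟩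
    · simp only [hq, map_mul]; exact norm_mul_le _ _
    · simp only [hq, map_mul, map_star, CStarRing.norm_star_mul_self, sq]
    · simp only [hq, FreeStarAlg.eval_gen]; exact hb x
    · rw [hq, hR r hr, norm_zero]
  exact le_univNorm this a

/-- The evaluation map as a continuous map on the free `*`-algebra with its seminorm. -/
theorem uniformContinuous_eval (b : X → B) (hb : ∀ x, ‖b x‖ ≤ 1)
    (hR : ∀ r ∈ R, FreeStarAlg.eval b r = 0) :
    UniformContinuous (fun a : PreUnivCStar R => FreeStarAlg.eval b (a : FreeStarAlg X)) := by
  let f : PreUnivCStar R →+ B := (FreeStarAlg.eval b : FreeStarAlg X →⋆ₐ[ℂ] B).toAlgHom.toAddMonoidHom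
  refine (AddMonoidHomClass.lipschitz_of_bound f 1 fun a => ?_).uniformContinuous
  rw [one_mul]
  exact norm_eval_le b hb hR a

/-- The continuous extension of the evaluation map. -/
def liftFun (R : Set (FreeStarAlg X)) (b : X → B) : UnivCStar R → B :=
  Completion.extension (fun a : PreUnivCStar R => FreeStarAlg.eval b (a : FreeStarAlg X))

theorem continuous_liftFun (b : X → B) : Continuous (liftFun R b) :=
  Completion.continuous_extension

theorem liftFun_mk (b : X → B) (hb : ∀ x, ‖b x‖ ≤ 1)
    (hR : ∀ r ∈ R, FreeStarAlg.eval b r = 0) (a : FreeStarAlg X) :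
    liftFun R b (mk R a) = FreeStarAlg.eval b a :=
  Completion.extension_coe (uniformContinuous_eval b hb hR) _

/-- The universal property: contractions satisfying the relations determine a `*`-homomorphism. -/
def lift (b : X → B) (hb : ∀ x, ‖b x‖ ≤ 1) (hR : ∀ r ∈ R, FreeStarAlg.eval b r = 0) :
    UnivCStar R →⋆ₐ[ℂ] B where
  toFun := liftFun R b
  map_one' := (liftFun_mk b hb hR 1).trans (map_one _)
  map_zero' := (liftFun_mk b hb hR 0).trans (map_zero _)
  map_mul' a a' := by
    have hc := continuous_liftFun (R := R) b
    induction a using induct with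
    | hc =>
      exact isClosed_eq (hc.comp (continuous_id.mul continuous_const)) (hc.mul continuous_const)
    | h a =>
      induction a' using induct with
      | hc =>
        exact isClosed_eq (hc.comp (continuous_const.mul continuous_id)) (continuous_const.mul hc)
      | h a' => simp only [← mk_mul, liftFun_mk b hb hR, map_mul]
  map_add' a a' := by
    have hc := continuous_liftFun (R := R) b
    induction a using induct with
    | hc =>
      exact isClosed_eq (hc.comp (continuous_id.add continuous_const)) (hc.add continuous_const)
    | h a =>
      induction a' using induct with
      | hc =>
        exact isClosed_eq (hc.comp (continuous_const.add continuous_id)) (continuous_const.add hc)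
      | h a' => simp only [← mk_add, liftFun_mk b hb hR, map_add]
  commutes' c := (liftFun_mk b hb hR _).trans ((FreeStarAlg.eval b).toAlgHom.commutes c)
  map_star' a := by
    have hc := continuous_liftFun (R := R) b
    change liftFun R b (star a) = star (liftFun R b a)
    induction a using induct with
    | hc => exact isClosed_eq (hc.comp continuous_star') (continuous_star.comp hc)
    | h a => simp only [← mk_star, liftFun_mk b hb hR, map_star]

@[simp] theorem lift_gen (b : X → B) (hb : ∀ x, ‖b x‖ ≤ 1)
    (hR : ∀ r ∈ R, FreeStarAlg.eval b r = 0) (x : X) : lift b hb hR (gen R x) = b x :=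
  (liftFun_mk b hb hR _).trans (FreeStarAlg.eval_gen b x)

end lift

/-- A closed `*`-subalgebra containing the generators is everything. -/
theorem induct_gen {P : UnivCStar R → Prop} (hc : IsClosed {a | P a})
    (h₀ : ∀ c : ℂ, P (algebraMap ℂ _ c)) (h₁ : ∀ x, P (gen R x)) (h₂ : ∀ x, P (star (gen R x)))
    (hm : ∀ a b, P a → P b → P (a * b)) (ha : ∀ a b, P a → P b → P (a + b))
    (a : UnivCStar R) : P a := by
  induction a using induct with
  | hc => exact hc
  | h a =>
    induction a using FreeStarAlg.induct with
    | h₀ c => exact h₀ c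
    | h₁ x => exact h₁ x
    | h₂ x => rw [← FreeStarAlg.star_gen, mk_star]; exact h₂ x
    | hm a b h h' => rw [mk_mul]; exact hm _ _ h h'
    | ha a b h h' => rw [mk_add]; exact ha _ _ h h'

end UnivCStar

/-! ### The Cuntz algebra and the 2-adic ring C*-algebra -/

/-- The two generators of the Cuntz algebra. -/
inductive CuntzGen | s1 | s2

/-- The two generators of the 2-adic ring C*-algebra. -/
inductive TwoAdicGen | u | s

/-- `x₁* x₁ = 1`, `x₂* x₂ = 1`, `x₁ x₁* + x₂ x₂* = 1`. -/
def cuntzRelations : Set (FreeStarAlg CuntzGen) :=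
  let x₁ := FreeStarAlg.gen CuntzGen.s1
  let x₂ := FreeStarAlg.gen CuntzGen.s2
  {star x₁ * x₁ - 1, star x₂ * x₂ - 1, x₁ * star x₁ + x₂ * star x₂ - 1}

/-- `u* u = 1`, `u u* = 1`, `s* s = 1`, `s u = u² s`, `s s* + u s s* u* = 1`. -/
def twoAdicRelations : Set (FreeStarAlg TwoAdicGen) :=
  let u := FreeStarAlg.gen TwoAdicGen.u
  let s := FreeStarAlg.gen TwoAdicGen.s
  {star u * u - 1, u * star u - 1, star s * s - 1, s * u - u ^ 2 * s,
    s * star s + u * s * star s * star u - 1}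

/-- The Cuntz algebra `O₂`: the universal C*-algebra generated by two isometries whose range
projections sum to `1`. -/
abbrev CuntzO2 : Type := UnivCStar cuntzRelations

/-- The 2-adic ring C*-algebra `Q₂`: the universal C*-algebra generated by a unitary `U` and an
isometry `S₂` with `S₂ U = U² S₂` and `S₂ S₂* + U S₂ S₂* U* = 1`. -/
abbrev TwoAdicQ2 : Type := UnivCStar twoAdicRelations

theorem norm_le_one_of_isometry {B : Type*} [CStarAlgebra B] {a : B} (h : star a * a = 1) :
    ‖a‖ ≤ 1 := by
  have h1 : ‖a‖ * ‖a‖ = ‖(1 : B)‖ := by rw [← CStarRing.norm_star_mul_self, h]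
  have h2 : ‖(1 : B)‖ * ‖(1 : B)‖ = ‖(1 : B)‖ := by
    rw [← CStarRing.norm_star_mul_self, star_one, one_mul]
  have h3 : ‖(1 : B)‖ ≤ 1 := by nlinarith [norm_nonneg (1 : B)]
  nlinarith [norm_nonneg a]

namespace CuntzO2

/-- The generating isometries. -/
def S (i : CuntzGen) : CuntzO2 := UnivCStar.gen cuntzRelations i

/-- The universal property of `O₂`. -/
def lift {B : Type*} [CStarAlgebra B] (x : CuntzGen → B) (h : ∀ i, star (x i) * x i = 1)
    (hsum : x .s1 * star (x .s1) + x .s2 * star (x .s2) = 1) : CuntzO2 →⋆ₐ[ℂ] B :=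
  UnivCStar.lift x (fun i => norm_le_one_of_isometry (h i)) (by
    intro r hr
    simp only [cuntzRelations, Set.mem_insert_iff, Set.mem_singleton_iff] at hr
    rcases hr with rfl | rfl | rfl <;>
      simp only [map_sub, map_add, map_mul, map_star, map_one, FreeStarAlg.eval_gen, h, hsum,
        sub_self])

@[simp] theorem lift_S {B : Type*} [CStarAlgebra B] (x : CuntzGen → B)
    (h : ∀ i, star (x i) * x i = 1)
    (hsum : x .s1 * star (x .s1) + x .s2 * star (x .s2) = 1) (i : CuntzGen) :
    lift x h hsum (S i) = x i := UnivCStar.lift_gen _ _ _ i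

end CuntzO2

namespace TwoAdicQ2

/-- The generating unitary. -/
def U : TwoAdicQ2 := UnivCStar.gen twoAdicRelations .u

/-- The generating isometry. -/
def S₂ : TwoAdicQ2 := UnivCStar.gen twoAdicRelations .s

theorem relation_eq {a b : FreeStarAlg TwoAdicGen} (h : a - b ∈ twoAdicRelations) :
    UnivCStar.mkHom twoAdicRelations a = UnivCStar.mkHom twoAdicRelations b := by
  rw [← sub_eq_zero, ← map_sub]
  exact UnivCStar.mkHom_eq_zero h

theorem star_U_mul_U : star U * U = 1 := by
  simpa only [U, UnivCStar.gen, map_mul, map_star, map_one] using relation_eq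
    (a := star (FreeStarAlg.gen TwoAdicGen.u) * FreeStarAlg.gen TwoAdicGen.u) (b := 1)
    (by simp [twoAdicRelations])

theorem star_S₂_mul_S₂ : star S₂ * S₂ = 1 := by
  simpa only [S₂, UnivCStar.gen, map_mul, map_star, map_one] using relation_eq
    (a := star (FreeStarAlg.gen TwoAdicGen.s) * FreeStarAlg.gen TwoAdicGen.s) (b := 1)
    (by simp [twoAdicRelations])

theorem range_sum : S₂ * star S₂ + U * S₂ * star S₂ * star U = 1 := by
  simpa only [U, S₂, UnivCStar.gen, map_add, map_mul, map_star, map_one] using relation_eq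
    (a := FreeStarAlg.gen TwoAdicGen.s * star (FreeStarAlg.gen TwoAdicGen.s) +
      FreeStarAlg.gen TwoAdicGen.u * FreeStarAlg.gen TwoAdicGen.s *
        star (FreeStarAlg.gen TwoAdicGen.s) * star (FreeStarAlg.gen TwoAdicGen.u)) (b := 1)
    (by simp [twoAdicRelations])

/-- The universal property of `Q₂`. -/
def lift {B : Type*} [CStarAlgebra B] (u s : B) (hu : star u * u = 1) (hu' : u * star u = 1)
    (hs : star s * s = 1) (hsu : s * u = u ^ 2 * s)
    (hsum : s * star s + u * s * star s * star u = 1) : TwoAdicQ2 →⋆ₐ[ℂ] B :=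
  UnivCStar.lift (TwoAdicGen.rec u s)
    (fun i => by
      cases i
      · exact norm_le_one_of_isometry hu
      · exact norm_le_one_of_isometry hs)
    (by
      intro r hr
      simp only [twoAdicRelations, Set.mem_insert_iff, Set.mem_singleton_iff] at hr
      rcases hr with rfl | rfl | rfl | rfl | rfl <;>
        simp only [map_sub, map_add, map_mul, map_star, map_one, map_pow, FreeStarAlg.eval_gen,
          hu, hu', hs, hsu, hsum, sub_self])

section

variable {B : Type*} [CStarAlgebra B] (u s : B) (hu : star u * u = 1) (hu' : u * star u = 1)
    (hs : star s * s = 1) (hsu : s * u = u ^ 2 * s)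
    (hsum : s * star s + u * s * star s * star u = 1)

@[simp] theorem lift_U : lift u s hu hu' hs hsu hsum U = u := UnivCStar.lift_gen _ _ _ TwoAdicGen.u

@[simp] theorem lift_S₂ : lift u s hu hu' hs hsu hsum S₂ = s :=
  UnivCStar.lift_gen _ _ _ TwoAdicGen.s

end

end TwoAdicQ2

/-- The inclusion `O₂ ⊂ Q₂`, `S₁ ↦ U S₂`, `S₂ ↦ S₂`. -/
def cuntzInclusion : CuntzO2 →⋆ₐ[ℂ] TwoAdicQ2 :=
  CuntzO2.lift (CuntzGen.rec (TwoAdicQ2.U * TwoAdicQ2.S₂) TwoAdicQ2.S₂)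
    (fun i => by
      cases i
      · change star (TwoAdicQ2.U * TwoAdicQ2.S₂) * (TwoAdicQ2.U * TwoAdicQ2.S₂) = 1
        rw [star_mul, mul_assoc, ← mul_assoc (star TwoAdicQ2.U), TwoAdicQ2.star_U_mul_U, one_mul,
          TwoAdicQ2.star_S₂_mul_S₂]
      · exact TwoAdicQ2.star_S₂_mul_S₂)
    (by
      change TwoAdicQ2.U * TwoAdicQ2.S₂ * star (TwoAdicQ2.U * TwoAdicQ2.S₂) +
        TwoAdicQ2.S₂ * star TwoAdicQ2.S₂ = 1
      rw [star_mul, ← mul_assoc, add_comm]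
      exact TwoAdicQ2.range_sum)

theorem cuntzInclusion_s1 :
    cuntzInclusion (CuntzO2.S .s1) = TwoAdicQ2.U * TwoAdicQ2.S₂ := CuntzO2.lift_S _ _ _ _

theorem cuntzInclusion_s2 : cuntzInclusion (CuntzO2.S .s2) = TwoAdicQ2.S₂ := CuntzO2.lift_S _ _ _ _

/-! ### The canonical representation -/

/-- The Hilbert space `ℓ²(ℤ)`. -/
abbrev L2Z : Type := lp (fun _ : ℤ => ℂ) 2

/-- The canonical orthonormal basis of `ℓ²(ℤ)`. -/
def stdBasis (k : ℤ) : L2Z := lp.single 2 k 1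

theorem inner_stdBasis (j k : ℤ) : ⟪stdBasis j, stdBasis k⟫_ℂ = if j = k then 1 else 0 := by
  rw [stdBasis, stdBasis, lp.inner_single_left, lp.single_apply, Pi.single_apply]
  split_ifs <;> simp

theorem orthonormal_comp {f : ℤ → ℤ} (hf : Function.Injective f) :
    Orthonormal ℂ (fun k => stdBasis (f k)) := by
  classical
  rw [orthonormal_iff_ite]
  intro i j
  rw [inner_stdBasis]
  simp only [hf.eq_iff]

/-- The isometry `e_k ↦ e_{f k}` of `ℓ²(ℤ)` attached to an injection `f` of `ℤ`. -/
def basisIsometry (f : ℤ → ℤ) (hf : Function.Injective f) : L2Z →L[ℂ] L2Z :=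
  (orthonormal_comp hf).orthogonalFamily.linearIsometry.toContinuousLinearMap

@[simp] theorem basisIsometry_apply (f : ℤ → ℤ) (hf : Function.Injective f) (k : ℤ) :
    basisIsometry f hf (stdBasis k) = stdBasis (f k) := by
  have := (orthonormal_comp hf).orthogonalFamily.linearIsometry_apply_single (i := k) (1 : ℂ)
  exact this.trans (by simp)

/-- Vectors of `ℓ²(ℤ)` are determined by their inner products with the basis. -/
theorem ext_inner {x y : L2Z} (h : ∀ k, ⟪stdBasis k, x⟫_ℂ = ⟪stdBasis k, y⟫_ℂ) : x = y := by
  ext k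
  simpa [stdBasis, lp.inner_single_left] using h k

/-- Operators on `ℓ²(ℤ)` are determined by their values on the basis. -/
theorem ext_basis {S T : L2Z →L[ℂ] L2Z} (h : ∀ k, S (stdBasis k) = T (stdBasis k)) : S = T := by
  have h' : ContinuousLinearMap.adjoint S = ContinuousLinearMap.adjoint T := by
    ext1 x
    refine ext_inner fun k => ?_
    rw [ContinuousLinearMap.adjoint_inner_right, ContinuousLinearMap.adjoint_inner_right, h]
  simpa using congrArg ContinuousLinearMap.adjoint h'

theorem star_basisIsometry_apply (f : ℤ → ℤ) (hf : Function.Injective f) (k : ℤ) :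
    star (basisIsometry f hf) (stdBasis (f k)) = stdBasis k := by
  refine ext_inner fun j => ?_
  rw [ContinuousLinearMap.star_eq_adjoint, ContinuousLinearMap.adjoint_inner_right,
    basisIsometry_apply, inner_stdBasis, inner_stdBasis]
  simp only [hf.eq_iff]

theorem star_basisIsometry_apply_zero (f : ℤ → ℤ) (hf : Function.Injective f) (k : ℤ)
    (hk : ∀ j, f j ≠ k) : star (basisIsometry f hf) (stdBasis k) = 0 := by
  refine ext_inner fun j => ?_
  rw [ContinuousLinearMap.star_eq_adjoint, ContinuousLinearMap.adjoint_inner_right,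
    basisIsometry_apply, inner_stdBasis, if_neg (hk j), inner_zero_right]

/-- The bilateral shift `e_k ↦ e_{k+1}`. -/
def shiftZ : L2Z →L[ℂ] L2Z := basisIsometry (fun k => k + 1) (add_left_injective 1)

/-- The isometry `e_k ↦ e_{2k}`. -/
def doubleZ : L2Z →L[ℂ] L2Z :=
  basisIsometry (fun k => 2 * k) (mul_right_injective₀ two_ne_zero)

theorem star_basisIsometry_mul (f : ℤ → ℤ) (hf : Function.Injective f) :
    star (basisIsometry f hf) * basisIsometry f hf = 1 :=
  ext_basis fun k => by
    rw [mul_apply_eq_comp, basisIsometry_apply, star_basisIsometry_apply]; rfl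

theorem shiftZ_apply (k : ℤ) : shiftZ (stdBasis k) = stdBasis (k + 1) := basisIsometry_apply _ _ k

theorem doubleZ_apply (k : ℤ) : doubleZ (stdBasis k) = stdBasis (2 * k) := basisIsometry_apply _ _ k

theorem star_shiftZ_apply (k : ℤ) : star shiftZ (stdBasis k) = stdBasis (k - 1) := by
  have := star_basisIsometry_apply (fun k => k + 1) (add_left_injective (1 : ℤ)) (k - 1)
  simpa using! this

theorem star_doubleZ_even (k : ℤ) : star doubleZ (stdBasis (2 * k)) = stdBasis k :=
  star_basisIsometry_apply _ _ k

theorem star_doubleZ_odd (k : ℤ) : star doubleZ (stdBasis (2 * k + 1)) = 0 :=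
  star_basisIsometry_apply_zero _ _ _ fun j => by change 2 * j ≠ _; omega

/-- The canonical representation `ρ_c` of `Q₂` on `ℓ²(ℤ)`: `U e_k = e_{k+1}`, `S₂ e_k = e_{2k}`. -/
def canonicalRep : TwoAdicQ2 →⋆ₐ[ℂ] (L2Z →L[ℂ] L2Z) :=
  TwoAdicQ2.lift shiftZ doubleZ (star_basisIsometry_mul _ _)
    (ext_basis fun k => by
      rw [mul_apply_eq_comp, star_shiftZ_apply, shiftZ_apply, sub_add_cancel]; rfl)
    (star_basisIsometry_mul _ _)
    (ext_basis fun k => by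
      simp only [sq, mul_apply_eq_comp, shiftZ_apply, doubleZ_apply]
      congr 1; ring)
    (ext_basis fun k => by
      simp only [add_apply, mul_apply_eq_comp, star_shiftZ_apply]
      obtain ⟨j, rfl | rfl⟩ := Int.even_or_odd' k
      · rw [star_doubleZ_even, doubleZ_apply,
          show 2 * j - 1 = 2 * (j - 1) + 1 by ring, star_doubleZ_odd]
        simp
      · rw [star_doubleZ_odd, add_sub_cancel_right, star_doubleZ_even, doubleZ_apply, shiftZ_apply]
        simp)

/-- The restriction `π_c` of the canonical representation to `O₂`. -/
def cuntzCanonicalRep : CuntzO2 →⋆ₐ[ℂ] (L2Z →L[ℂ] L2Z) := canonicalRep.comp cuntzInclusion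

theorem canonicalRep_U : canonicalRep TwoAdicQ2.U = shiftZ := TwoAdicQ2.lift_U _ _ _ _ _ _ _

theorem canonicalRep_S₂ : canonicalRep TwoAdicQ2.S₂ = doubleZ := TwoAdicQ2.lift_S₂ _ _ _ _ _ _ _

theorem cuntzCanonicalRep_s1 : cuntzCanonicalRep (CuntzO2.S .s1) = shiftZ * doubleZ := by
  rw [cuntzCanonicalRep, StarAlgHom.comp_apply, cuntzInclusion_s1, map_mul, canonicalRep_U,
    canonicalRep_S₂]

theorem cuntzCanonicalRep_s2 : cuntzCanonicalRep (CuntzO2.S .s2) = doubleZ := by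
  rw [cuntzCanonicalRep, StarAlgHom.comp_apply, cuntzInclusion_s2, canonicalRep_S₂]

/-! ### Subrepresentations and the representations `π₊`, `π₋` -/

/-- The restriction of a representation to a closed invariant subspace. -/
def subrep {A : Type*} [CStarAlgebra A] {H : Type*} [NormedAddCommGroup H]
    [InnerProductSpace ℂ H] [CompleteSpace H] (π : A →⋆ₐ[ℂ] (H →L[ℂ] H)) (K : Submodule ℂ H)
    [CompleteSpace K] (hK : ∀ a, ∀ v ∈ K, π a v ∈ K) : A →⋆ₐ[ℂ] (K →L[ℂ] K) where
  toFun a := ((π a).comp K.subtypeL).codRestrict K (fun v => hK a v v.2)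
  map_one' := by ext v; simp
  map_mul' a b := by
    ext v; exact congrArg (fun T : H →L[ℂ] H => T v) (map_mul π a b)
  map_zero' := by ext v; simp
  map_add' a b := by
    ext v; exact congrArg (fun T : H →L[ℂ] H => T v) (map_add π a b)
  commutes' c := by ext v; simp [Algebra.algebraMap_eq_smul_one]
  map_star' a := by
    rw [ContinuousLinearMap.star_eq_adjoint, ContinuousLinearMap.eq_adjoint_iff]
    intro v w
    change ⟪π (star a) v, (w : H)⟫_ℂ = ⟪(v : H), π a w⟫_ℂ
    rw [map_star, ContinuousLinearMap.star_eq_adjoint, ContinuousLinearMap.adjoint_inner_left]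

/-- The closed linear span of the basis vectors `e_k`, `k ∈ s`. -/
abbrev basisSpan (s : Set ℤ) : Submodule ℂ L2Z :=
  (Submodule.span ℂ (stdBasis '' s)).topologicalClosure

theorem basisSpan_invariant {s : Set ℤ} {T : L2Z →L[ℂ] L2Z}
    (h : ∀ k ∈ s, T (stdBasis k) ∈ basisSpan s) : ∀ v ∈ basisSpan s, T v ∈ basisSpan s := by
  have h1 : Submodule.span ℂ (stdBasis '' s) ≤ (basisSpan s).comap T.toLinearMap :=
    Submodule.span_le.2 (by rintro _ ⟨k, hk, rfl⟩; exact h k hk)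
  exact Submodule.topologicalClosure_minimal _ h1
    ((Submodule.isClosed_topologicalClosure _).preimage T.continuous)

theorem stdBasis_mem {s : Set ℤ} {k : ℤ} (hk : k ∈ s) : stdBasis k ∈ basisSpan s :=
  Submodule.le_topologicalClosure _ (Submodule.subset_span ⟨k, hk, rfl⟩)

/-- If `k ∈ s ↔ 2k ∈ s ↔ 2k+1 ∈ s`, the closed span of `{e_k : k ∈ s}` is invariant under `O₂`. -/
theorem cuntz_invariant {s : Set ℤ} (h0 : ∀ k, 2 * k ∈ s ↔ k ∈ s) (h1 : ∀ k, 2 * k + 1 ∈ s ↔ k ∈ s)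
    (a : CuntzO2) : ∀ v ∈ basisSpan s, cuntzCanonicalRep a v ∈ basisSpan s := by
  have hcont : Continuous cuntzCanonicalRep :=
    AddMonoidHomClass.continuous_of_bound cuntzCanonicalRep 1 fun a => by
      rw [one_mul]; exact NonUnitalStarAlgHom.norm_apply_le cuntzCanonicalRep a
  induction a using UnivCStar.induct_gen with
  | hc =>
    simp only [Set.ofPred_forall]
    exact isClosed_iInter fun v => isClosed_iInter fun _ =>
      (Submodule.isClosed_topologicalClosure _).preimage
        ((ContinuousLinearMap.apply ℂ L2Z v).continuous.comp hcont)
  | h₀ c =>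
    intro v hv
    have : cuntzCanonicalRep (algebraMap ℂ _ c) v = c • v := by
      rw [AlgHomClass.commutes, Algebra.algebraMap_eq_smul_one]; rfl
    rw [this]
    exact Submodule.smul_mem _ c hv
  | h₁ x =>
    refine basisSpan_invariant fun k hk => ?_
    cases x
    · erw [cuntzCanonicalRep_s1]
      rw [mul_apply_eq_comp, doubleZ_apply, shiftZ_apply]
      exact stdBasis_mem ((h1 k).2 hk)
    · erw [cuntzCanonicalRep_s2]
      rw [doubleZ_apply]
      exact stdBasis_mem ((h0 k).2 hk)
  | h₂ x =>
    refine basisSpan_invariant fun k hk => ?_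
    rw [map_star]
    cases x
    · erw [cuntzCanonicalRep_s1]
      rw [star_mul, mul_apply_eq_comp, star_shiftZ_apply]
      obtain ⟨j, rfl | rfl⟩ := Int.even_or_odd' k
      · rw [show 2 * j - 1 = 2 * (j - 1) + 1 by ring, star_doubleZ_odd]
        exact Submodule.zero_mem _
      · rw [add_sub_cancel_right, star_doubleZ_even]
        exact stdBasis_mem ((h1 j).1 hk)
    · erw [cuntzCanonicalRep_s2]
      obtain ⟨j, rfl | rfl⟩ := Int.even_or_odd' k
      · rw [star_doubleZ_even]
        exact stdBasis_mem ((h0 j).1 hk)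
      · rw [star_doubleZ_odd]
        exact Submodule.zero_mem _
  | hm a b ha hb =>
    intro v hv
    rw [map_mul, mul_apply_eq_comp]
    exact ha _ (hb v hv)
  | ha a b ha hb =>
    intro v hv
    rw [map_add, add_apply]
    exact Submodule.add_mem _ (ha v hv) (hb v hv)

/-- `H₊`, the closed span of `{e_k : k ≥ 0}`. -/
abbrev HPlus : Submodule ℂ L2Z := basisSpan {k | 0 ≤ k}

/-- `H₋`, the closed span of `{e_k : k < 0}`. -/
abbrev HMinus : Submodule ℂ L2Z := basisSpan {k | k < 0}

/-- The representation `π₊` of `O₂` on `H₊`. -/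
def piPlus : CuntzO2 →⋆ₐ[ℂ] (HPlus →L[ℂ] HPlus) :=
  subrep cuntzCanonicalRep HPlus (cuntz_invariant
    (fun k => by simp only [Set.mem_ofPred_eq]; omega)
    (fun k => by simp only [Set.mem_ofPred_eq]; omega))

/-- The representation `π₋` of `O₂` on `H₋`. -/
def piMinus : CuntzO2 →⋆ₐ[ℂ] (HMinus →L[ℂ] HMinus) :=
  subrep cuntzCanonicalRep HMinus (cuntz_invariant
    (fun k => by simp only [Set.mem_ofPred_eq]; omega)
    (fun k => by simp only [Set.mem_ofPred_eq]; omega))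

/-! ### Permutative representations -/

/-- The representation `π` of `O₂` is of type `P(i)`, `i ∈ {1, 2}`: it is permutative (for some
orthonormal basis `(e_n)` and some branching function system `(σ₁, σ₂)` on `ℕ`, one has
`π(S_j) e_n = e_{σ_j(n)}`), and it has a cyclic basis vector fixed by `π(S_i)`. -/
def IsOfTypeP {H : Type*} [NormedAddCommGroup H] [InnerProductSpace ℂ H] [CompleteSpace H]
    (i : CuntzGen) (π : CuntzO2 →⋆ₐ[ℂ] (H →L[ℂ] H)) : Prop :=
  ∃ (e : HilbertBasis ℕ ℂ H) (σ : CuntzGen → ℕ → ℕ),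
    (∀ j, Function.Injective (σ j)) ∧
    IsCompl (Set.range (σ .s1)) (Set.range (σ .s2)) ∧
    (∀ j n, π (CuntzO2.S j) (e n) = e (σ j n)) ∧
    ∃ n, π (CuntzO2.S i) (e n) = e n ∧ Dense (Set.range fun a : CuntzO2 => π a (e n))

/-! ### States -/

/-- The states of a unital C*-algebra: positive linear functionals with value `1` at `1`. -/
def states (A : Type*) [CStarAlgebra A] : Set (A →ₗ[ℂ] ℂ) :=
  {ω | (∀ a, 0 ≤ ω (star a * a)) ∧ ω 1 = 1}

/-- The pure states: the extreme points of the convex set of states. -/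
def pureStates (A : Type*) [CStarAlgebra A] : Set (A →ₗ[ℂ] ℂ) :=
  (states A).extremePoints ℝ

/-- The functional `a ↦ (π(a) x, x)` (linear in its first entry, so `⟪x, π a x⟫` in Mathlib's
convention, linear in the second entry); it is a state if `‖x‖ = 1`. -/
def vectorState {A : Type*} [CStarAlgebra A] {H : Type*} [NormedAddCommGroup H]
    [InnerProductSpace ℂ H] [CompleteSpace H] (π : A →⋆ₐ[ℂ] (H →L[ℂ] H)) (x : H) : A →ₗ[ℂ] ℂ where
  toFun a := ⟪x, π a x⟫_ℂ
  map_add' a b := by simp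
  map_smul' c a := by simp

/-- The unique extension property of a pure state `ω` of `O₂` with respect to `O₂ ⊂ Q₂`: exactly
one pure state of `Q₂` restricts to `ω`. -/
def HasUniquePureExtension (ω : CuntzO2 →ₗ[ℂ] ℂ) : Prop :=
  ∃! Ω : TwoAdicQ2 →ₗ[ℂ] ℂ, Ω ∈ pureStates TwoAdicQ2 ∧ ∀ T : CuntzO2, Ω (cuntzInclusion T) = ω T

end

/-!
Let `t = S_i`. On `O₂`, a bounded functional `φ` with `φ(a t) = φ(a) = φ(t* a)` for all `a` is
determined by `φ(1)`: it kills the left ideal `O₂ (t - 1)`, which together with the words in `S₁`,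
`S₂` spans a dense subspace, and its value at a word is that at the word shortened by `t*`, or zero.
On `Q₂` the image of `t` is `U ^ d S₂` with `d ∈ {0, 1}` and the same holds, with the powers `U ^ k`
in place of the words: `φ(U ^ k) = φ(t* U ^ k t)` is `φ(U ^ (k / 2))` for even `k` and zero for odd
`k`.

Matrix coefficients of `t`-fixed vectors are such functionals. On `O₂` this makes the fixed space of
`π(t)` a line when there is a cyclic fixed vector `e`, so `π` is irreducible and its vector states
are pure. If a state `Ω` of `Q₂` extends `ω_x`, the GNS construction gives a representation `ρ` of
`Q₂` and an isometry `V` intertwining `π` with `ρ` on `O₂` such that `Ω` is the vector state of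
`V x`. As `V e` is `t`-fixed, its vector state on `Q₂` does not depend on `Ω`, hence neither does
that of `V x`. An extension exists because `ρ_c(t)` has a fixed vector.
-/

/-! ### Representations and intertwiners -/

section Representations

open scoped CStarAlgebra

variable {A : Type*} [CStarAlgebra A]
  {H : Type*} [NormedAddCommGroup H] [InnerProductSpace ℂ H] [CompleteSpace H]
  {K : Type*} [NormedAddCommGroup K] [InnerProductSpace ℂ K] [CompleteSpace K]

theorem inner_map_map (π : A →⋆ₐ[ℂ] (H →L[ℂ] H)) (a b : A) (x y : H) :
    ⟪π a x, π b y⟫_ℂ = ⟪x, π (star a * b) y⟫_ℂ := by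
  rw [map_mul, map_star, ContinuousLinearMap.star_eq_adjoint, mul_apply_eq_comp,
    ContinuousLinearMap.adjoint_inner_right]

/-- The matrix coefficient `a ↦ (π(a) y, x)` of a representation, as a bounded functional. -/
noncomputable def matrixCoeff (π : A →⋆ₐ[ℂ] (H →L[ℂ] H)) (x y : H) : A →L[ℂ] ℂ :=
  innerSL ℂ x ∘L ContinuousLinearMap.apply ℂ H y ∘L
    ContinuousLinearMap.mk π.toAlgHom.toLinearMap (map_continuous π)

@[simp]
theorem matrixCoeff_apply (π : A →⋆ₐ[ℂ] (H →L[ℂ] H)) (x y : H) (a : A) :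
    matrixCoeff π x y a = ⟪x, π a y⟫_ℂ := rfl

theorem vectorState_apply (π : A →⋆ₐ[ℂ] (H →L[ℂ] H)) (x : H) (a : A) :
    vectorState π x a = ⟪x, π a x⟫_ℂ := rfl

theorem vectorState_star_mul_self (π : A →⋆ₐ[ℂ] (H →L[ℂ] H)) (x : H) (a : A) :
    vectorState π x (star a * a) = (‖π a x‖ : ℂ) ^ 2 := by
  rw [vectorState_apply, ← inner_map_map, inner_self_eq_norm_sq_to_K]
  norm_cast

theorem vectorState_one (π : A →⋆ₐ[ℂ] (H →L[ℂ] H)) (x : H) :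
    vectorState π x 1 = (‖x‖ : ℂ) ^ 2 := by
  simpa using vectorState_star_mul_self π x 1

theorem vectorState_nonneg (π : A →⋆ₐ[ℂ] (H →L[ℂ] H)) (x : H) (a : A) :
    0 ≤ vectorState π x (star a * a) := by
  rw [vectorState_star_mul_self]
  positivity

theorem vectorState_mem_states (π : A →⋆ₐ[ℂ] (H →L[ℂ] H)) {x : H} (hx : ‖x‖ = 1) :
    vectorState π x ∈ states A :=
  ⟨vectorState_nonneg π x, by simp [vectorState_one, hx]⟩

theorem norm_map_eq_of_vectorState_eq {π : A →⋆ₐ[ℂ] (H →L[ℂ] H)} {ρ : A →⋆ₐ[ℂ] (K →L[ℂ] K)}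
    {x : H} {y : K} (h : vectorState π x = vectorState ρ y) (a : A) : ‖π a x‖ = ‖ρ a y‖ := by
  have := congrArg (fun φ : A →ₗ[ℂ] ℂ => φ (star a * a)) h
  simp only [vectorState_star_mul_self] at this
  norm_cast at this
  exact (pow_left_inj₀ (norm_nonneg _) (norm_nonneg _) two_ne_zero).1 this

theorem norm_eq_of_vectorState_eq {π : A →⋆ₐ[ℂ] (H →L[ℂ] H)} {ρ : A →⋆ₐ[ℂ] (K →L[ℂ] K)}
    {x : H} {y : K} (h : vectorState π x = vectorState ρ y) : ‖x‖ = ‖y‖ := by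
  simpa using norm_map_eq_of_vectorState_eq h 1

universe v in
theorem exists_vectorState_eq {A : Type v} [CStarAlgebra A] {φ : A →ₗ[ℂ] ℂ}
    (hφ : ∀ a, 0 ≤ φ (star a * a)) :
    ∃ (K : Type v) (_ : NormedAddCommGroup K) (_ : InnerProductSpace ℂ K) (_ : CompleteSpace K)
      (ρ : A →⋆ₐ[ℂ] (K →L[ℂ] K)) (ξ : K), vectorState ρ ξ = φ := by
  let _ : PartialOrder A := CStarAlgebra.spectralOrder A
  have : StarOrderedRing A := CStarAlgebra.spectralOrderedRing A
  let f : A →ₚ[ℂ] ℂ := PositiveLinearMap.mk₀ φ fun a ha => by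
    obtain ⟨b, rfl⟩ := CStarAlgebra.nonneg_iff_eq_star_mul_self.1 ha
    exact hφ b
  refine ⟨f.GNS, inferInstance, inferInstance, inferInstance, f.gnsStarAlgHom,
    ((f.toPreGNS 1 : f.PreGNS) : f.GNS), LinearMap.ext fun a => ?_⟩
  have hf : φ a = f a := rfl
  rw [hf, vectorState_apply, PositiveLinearMap.gnsStarAlgHom_apply]
  simp [PositiveLinearMap.preGNS_inner_def]

/-- `V` intertwines the representations `π` and `ρ`. -/
def Intertwines (π : A →⋆ₐ[ℂ] (H →L[ℂ] H)) (ρ : A →⋆ₐ[ℂ] (K →L[ℂ] K)) (V : H →L[ℂ] K) : Prop :=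
  ∀ a y, V (π a y) = ρ a (V y)

/-- The vector `x` is cyclic for `π`: its orbit `π(A) x` is dense. -/
def IsCyclicVector (π : A →⋆ₐ[ℂ] (H →L[ℂ] H)) (x : H) : Prop :=
  Dense (Set.range fun a => π a x)

theorem exists_intertwiner_of_norm_le {π : A →⋆ₐ[ℂ] (H →L[ℂ] H)} {ρ : A →⋆ₐ[ℂ] (K →L[ℂ] K)}
    {x : H} {ξ : K} (hx : IsCyclicVector π x) (C : ℝ) (h : ∀ a, ‖ρ a ξ‖ ≤ C * ‖π a x‖) :
    ∃ V : H →L[ℂ] K, Intertwines π ρ V ∧ V x = ξ := by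
  let e : A →ₗ[ℂ] H := (ContinuousLinearMap.apply ℂ H x).toLinearMap ∘ₗ π.toAlgHom.toLinearMap
  let f : A →ₗ[ℂ] K := (ContinuousLinearMap.apply ℂ K ξ).toLinearMap ∘ₗ ρ.toAlgHom.toLinearMap
  have hV : ∀ a, f.extendOfNorm e (π a x) = ρ a ξ :=
    LinearMap.extendOfNorm_eq (f := f) (e := e) hx ⟨C, h⟩
  refine ⟨f.extendOfNorm e, fun a y => ?_, by simpa using hV 1⟩
  refine hx.induction (P := fun y => f.extendOfNorm e (π a y) = ρ a (f.extendOfNorm e y)) ?_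
    (isClosed_eq (by fun_prop) (by fun_prop)) y
  rintro _ ⟨b, rfl⟩
  simp only [hV]
  rw [← mul_apply_eq_comp, ← map_mul, hV, map_mul, mul_apply_eq_comp]

/-- At `x = π(a) e` both sides are the value of the vector state of `e` on `ι(a)* b ι(a)`. -/
theorem vectorState_map_eq_of_isCyclicVector {B : Type*} [CStarAlgebra B] (ι : A →⋆ₐ[ℂ] B)
    {L : Type*} [NormedAddCommGroup L] [InnerProductSpace ℂ L] [CompleteSpace L]
    {π : A →⋆ₐ[ℂ] (H →L[ℂ] H)} {ρ : B →⋆ₐ[ℂ] (K →L[ℂ] K)} {σ : B →⋆ₐ[ℂ] (L →L[ℂ] L)}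
    {V : H →L[ℂ] K} {W : H →L[ℂ] L} (hV : Intertwines π (ρ.comp ι) V)
    (hW : Intertwines π (σ.comp ι) W) {e : H} (he : IsCyclicVector π e)
    (h : vectorState ρ (V e) = vectorState σ (W e)) (x : H) :
    vectorState ρ (V x) = vectorState σ (W x) := by
  ext b
  simp only [vectorState_apply]
  refine he.induction (P := fun x => ⟪V x, ρ b (V x)⟫_ℂ = ⟪W x, σ b (W x)⟫_ℂ) ?_
    (isClosed_eq (by fun_prop) (by fun_prop)) x
  rintro _ ⟨a, rfl⟩
  simp only [hV a, hW a, StarAlgHom.comp_apply]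
  rw [← mul_apply_eq_comp, ← mul_apply_eq_comp, ← map_mul, ← map_mul, inner_map_map,
    inner_map_map]
  exact congrArg (fun φ : B →ₗ[ℂ] ℂ => φ (star (ι a) * (b * ι a))) h

theorem exists_intertwiner_of_vectorState_eq {π : A →⋆ₐ[ℂ] (H →L[ℂ] H)}
    {ρ : A →⋆ₐ[ℂ] (K →L[ℂ] K)} {x : H} {ξ : K} (hx : IsCyclicVector π x)
    (h : vectorState ρ ξ = vectorState π x) :
    ∃ V : H →L[ℂ] K, Intertwines π ρ V ∧ V x = ξ ∧
      ∀ y, vectorState ρ (V y) = vectorState π y := by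
  obtain ⟨V, hV, hVx⟩ := exists_intertwiner_of_norm_le hx 1 fun a => by
    rw [one_mul, norm_map_eq_of_vectorState_eq h]
  refine ⟨V, hV, hVx, ?_⟩
  exact vectorState_map_eq_of_isCyclicVector (StarAlgHom.id ℂ A) (W := .id ℂ H) hV
    (fun _ _ => rfl) hx (by rw [hVx]; exact h)

/-- The commutant of `π` consists of the scalars, that is, `π` is irreducible. -/
def HasTrivialCommutant (π : A →⋆ₐ[ℂ] (H →L[ℂ] H)) : Prop :=
  ∀ T : H →L[ℂ] H, (∀ a, Commute T (π a)) → ∃ c : ℂ, T = c • 1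

theorem HasTrivialCommutant.isCyclicVector {π : A →⋆ₐ[ℂ] (H →L[ℂ] H)}
    (hπ : HasTrivialCommutant π) {x : H} (hx : x ≠ 0) : IsCyclicVector π x := by
  let M : Submodule ℂ H := LinearMap.range
    ((ContinuousLinearMap.apply ℂ H x).toLinearMap ∘ₗ π.toAlgHom.toLinearMap)
  have hM (a : A) : M.topologicalClosure ∈ Module.End.invtSubmodule (π a).toLinearMap := by
    refine Submodule.topologicalClosure_mem_invtSubmodule ?_
    rintro _ ⟨b, rfl⟩
    exact ⟨a * b, congrArg (fun T : H →L[ℂ] H => T x) (map_mul π a b)⟩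
  have hM' (a : A) : M.topologicalClosureᗮ ∈ Module.End.invtSubmodule (π a).toLinearMap := by
    refine ContinuousLinearMap.orthogonal_mem_invtSubmodule ?_
    rw [← ContinuousLinearMap.star_eq_adjoint, ← map_star]
    exact hM (star a)
  obtain ⟨c, hc⟩ := hπ M.topologicalClosure.starProjection fun a => by
    rw [ContinuousLinearMap.IsIdempotentElem.commute_iff
      (Submodule.isIdempotentElem_starProjection _), Submodule.range_starProjection,
      Submodule.ker_starProjection]
    exact ⟨hM a, hM' a⟩
  have hxM : x ∈ M.topologicalClosure := M.le_topologicalClosure ⟨1, by simp⟩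
  have hc1 : c = 1 := by
    have hcx : c • x = x := by
      have := Submodule.starProjection_eq_self_iff.2 hxM
      rwa [hc] at this
    exact smul_left_injective ℂ hx (hcx.trans (one_smul ℂ x).symm)
  refine (Submodule.dense_iff_topologicalClosure_eq_top (s := M)).2 ?_
  rw [← Submodule.range_starProjection M.topologicalClosure, hc, hc1, one_smul]
  exact LinearMap.range_id

theorem Intertwines.adjoint_comp_commute {π : A →⋆ₐ[ℂ] (H →L[ℂ] H)} {ρ : A →⋆ₐ[ℂ] (K →L[ℂ] K)}
    {V : H →L[ℂ] K} (hV : Intertwines π ρ V) (a : A) : Commute (V.adjoint ∘L V) (π a) := by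
  ext y
  refine ext_inner_left ℂ fun z => ?_
  have hadj : ∀ w, ⟪π (star a) z, w⟫_ℂ = ⟪z, π a w⟫_ℂ := fun w => by
    rw [map_star, ContinuousLinearMap.star_eq_adjoint, ContinuousLinearMap.adjoint_inner_left]
  simp only [mul_apply_eq_comp, ContinuousLinearMap.comp_apply]
  rw [ContinuousLinearMap.adjoint_inner_right, hV, ← hadj, ContinuousLinearMap.adjoint_inner_right,
    hV, map_star, ContinuousLinearMap.star_eq_adjoint, ContinuousLinearMap.adjoint_inner_left]

/-- By the GNS construction `φ` is the vector functional of `V x` for an intertwiner `V`, and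
`V* V` is a scalar. -/
theorem HasTrivialCommutant.eq_smul_vectorState {π : A →⋆ₐ[ℂ] (H →L[ℂ] H)}
    (hπ : HasTrivialCommutant π) {x : H} (hx : x ≠ 0) {φ : A →ₗ[ℂ] ℂ}
    (hφ : ∀ a, 0 ≤ φ (star a * a)) (hle : ∀ a, φ (star a * a) ≤ vectorState π x (star a * a)) :
    ∃ c : ℂ, φ = c • vectorState π x := by
  obtain ⟨K, _, _, _, ρ, ξ, rfl⟩ := exists_vectorState_eq hφ
  obtain ⟨V, hV, rfl⟩ := exists_intertwiner_of_norm_le (hπ.isCyclicVector hx) (ξ := ξ) 1 fun a => by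
    have := hle a
    simp only [vectorState_star_mul_self] at this
    norm_cast at this
    rw [one_mul]
    exact (pow_le_pow_iff_left₀ (norm_nonneg _) (norm_nonneg _) two_ne_zero).1 this
  obtain ⟨c, hc⟩ := hπ _ hV.adjoint_comp_commute
  refine ⟨c, LinearMap.ext fun a => ?_⟩
  have hVa : V.adjoint (V (π a x)) = c • π a x := congrArg (fun T : H →L[ℂ] H => T (π a x)) hc
  rw [vectorState_apply, ← hV, ← ContinuousLinearMap.adjoint_inner_right, hVa, inner_smul_right]
  rfl

theorem HasTrivialCommutant.vectorState_mem_pureStates {π : A →⋆ₐ[ℂ] (H →L[ℂ] H)}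
    (hπ : HasTrivialCommutant π) {x : H} (hx : ‖x‖ = 1) : vectorState π x ∈ pureStates A := by
  have hx0 : x ≠ 0 := norm_ne_zero_iff.1 (by simp [hx])
  refine ⟨vectorState_mem_states π hx, fun φ hφ ψ hψ hmem => ?_⟩
  obtain ⟨s, t, hs, ht, -, hst⟩ := hmem
  have hle (a : A) : (s • φ) (star a * a) ≤ vectorState π x (star a * a) := by
    rw [← hst]
    exact le_add_of_nonneg_right (smul_nonneg ht.le (hψ.1 a))
  obtain ⟨c, hc⟩ := hπ.eq_smul_vectorState hx0 (fun a => smul_nonneg hs.le (hφ.1 a)) hle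
  have hcs : (s : ℂ) = c := by
    simpa [hφ.2, vectorState_one, hx] using congrArg (fun φ : A →ₗ[ℂ] ℂ => φ 1) hc
  rw [← hcs, Complex.coe_smul] at hc
  exact smul_right_injective _ hs.ne' hc

end Representations

theorem comp_mem_states {A B : Type*} [CStarAlgebra A] [CStarAlgebra B] (ι : A →⋆ₐ[ℂ] B)
    {φ : B →ₗ[ℂ] ℂ} (hφ : φ ∈ states B) : φ ∘ₗ ι.toAlgHom.toLinearMap ∈ states A := by
  refine ⟨fun a => ?_, (congrArg φ (map_one ι)).trans hφ.2⟩
  change 0 ≤ φ (ι (star a * a))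
  rw [map_mul, map_star]
  exact hφ.1 (ι a)

/-- The unique state extension is pure: the end points of a segment through it restrict to end
points of a segment through `ω`. -/
theorem existsUnique_pure_extension {A B : Type*} [CStarAlgebra A] [CStarAlgebra B]
    (ι : A →⋆ₐ[ℂ] B) {ω : A →ₗ[ℂ] ℂ} (hω : ω ∈ pureStates A)
    (h : ∃! Ω : B →ₗ[ℂ] ℂ, Ω ∈ states B ∧ ∀ a, Ω (ι a) = ω a) :
    ∃! Ω : B →ₗ[ℂ] ℂ, Ω ∈ pureStates B ∧ ∀ a, Ω (ι a) = ω a := by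
  obtain ⟨Ω, ⟨hΩ, hΩω⟩, huniq⟩ := h
  refine ⟨Ω, ⟨⟨hΩ, fun φ hφ ψ hψ hmem => ?_⟩, hΩω⟩, fun Ω' h' => huniq Ω' ⟨h'.1.1, h'.2⟩⟩
  obtain ⟨s, t, hs, ht, hst, heq⟩ := hmem
  have := hω.2 (comp_mem_states ι hφ) (comp_mem_states ι hψ)
    ⟨s, t, hs, ht, hst, LinearMap.ext fun a => by rw [← hΩω, ← heq]; rfl⟩
  exact huniq φ ⟨hφ, fun a => congrArg (fun f : A →ₗ[ℂ] ℂ => f a) this⟩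

/-! ### Functionals fixed by translation by one element -/

section FixedFunctionals

variable {A : Type*} [CStarAlgebra A]
  {H : Type*} [NormedAddCommGroup H] [InnerProductSpace ℂ H] [CompleteSpace H]
  {K : Type*} [NormedAddCommGroup K] [InnerProductSpace ℂ K] [CompleteSpace K]

/-- A bounded functional `φ` with `φ(a t) = φ(a) = φ(t* a)` for all `a` is determined by `φ(1)`.
The matrix coefficients of `t`-fixed vectors are functionals of this kind. -/
def HasUniqueFixedFunctional (t : A) : Prop :=
  ∀ φ : A →L[ℂ] ℂ, (∀ a, φ (a * t) = φ a) → (∀ a, φ (star t * a) = φ a) → φ 1 = 0 → φ = 0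

variable {t : A} {π : A →⋆ₐ[ℂ] (H →L[ℂ] H)} {ρ : A →⋆ₐ[ℂ] (K →L[ℂ] K)}

theorem matrixCoeff_mul_right {x y : H} (hy : π t y = y) (a : A) :
    matrixCoeff π x y (a * t) = matrixCoeff π x y a := by
  simp [hy]

theorem matrixCoeff_star_mul {x y : H} (hx : π t x = x) (a : A) :
    matrixCoeff π x y (star t * a) = matrixCoeff π x y a := by
  rw [matrixCoeff_apply, ← inner_map_map, hx, matrixCoeff_apply]

theorem HasUniqueFixedFunctional.vectorState_eq (ht : HasUniqueFixedFunctional t) {x : H} {y : K}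
    (hx : π t x = x) (hy : ρ t y = y) (hxy : ‖x‖ = ‖y‖) : vectorState π x = vectorState ρ y := by
  have : matrixCoeff π x x - matrixCoeff ρ y y = 0 := by
    refine ht _ (fun a => ?_) (fun a => ?_) ?_
    · simp only [sub_apply, matrixCoeff_mul_right hx, matrixCoeff_mul_right hy]
    · simp only [sub_apply, matrixCoeff_star_mul hx, matrixCoeff_star_mul hy]
    · simp [inner_self_eq_norm_sq_to_K, hxy]
  exact LinearMap.ext fun a => congrArg (fun φ : A →L[ℂ] ℂ => φ a) (sub_eq_zero.1 this)

theorem HasUniqueFixedFunctional.eq_zero_of_inner_eq_zero (ht : HasUniqueFixedFunctional t)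
    {e f : H} (hc : IsCyclicVector π e) (he : π t e = e) (hf : π t f = f) (hef : ⟪e, f⟫_ℂ = 0) :
    f = 0 := by
  have hφ : matrixCoeff π f e = 0 :=
    ht _ (matrixCoeff_mul_right he) (matrixCoeff_star_mul hf)
      (by simpa using inner_eq_zero_symm.1 hef)
  refine hc.eq_zero_of_inner_left ℂ ?_
  rintro _ ⟨a, rfl⟩
  exact congrArg (fun φ : A →L[ℂ] ℂ => φ a) hφ

/-- The fixed vectors of `π t` form a line, so the cyclic fixed vector is an eigenvector of every
operator in the commutant. -/
theorem HasUniqueFixedFunctional.hasTrivialCommutant (ht : HasUniqueFixedFunctional t)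
    {e : H} (hc : IsCyclicVector π e) (he : π t e = e) : HasTrivialCommutant π := by
  intro T hT
  have hTπ : ∀ a y, T (π a y) = π a (T y) := fun a y =>
    congrArg (fun R : H →L[ℂ] H => R y) (hT a)
  set c : ℂ := ⟪e, T e⟫_ℂ / ⟪e, e⟫_ℂ
  have horth : ⟪e, T e - c • e⟫_ℂ = 0 := by
    rw [inner_sub_right, inner_smul_right, div_mul_cancel_of_imp, sub_self]
    intro h
    rw [inner_self_eq_zero.1 h, inner_zero_left]
  have hTe : T e = c • e := sub_eq_zero.1 <|
    ht.eq_zero_of_inner_eq_zero hc he (by rw [map_sub, map_smul, ← hTπ, he]) horth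
  refine ⟨c, ContinuousLinearMap.coeFn_injective ?_⟩
  refine T.continuous.ext_on hc (ContinuousLinearMap.continuous _) ?_
  rintro _ ⟨a, rfl⟩
  simp [hTπ, hTe]

theorem Intertwines.map_fixed {V : H →L[ℂ] K} (hV : Intertwines π ρ V) {x : H} (hx : π t x = x) :
    ρ t (V x) = V x := by
  rw [← hV, hx]

theorem existsUnique_state_extension {B : Type*} [CStarAlgebra B] (ι : A →⋆ₐ[ℂ] B)
    (ht : HasUniqueFixedFunctional t) (hιt : HasUniqueFixedFunctional (ι t))
    {L : Type*} [NormedAddCommGroup L] [InnerProductSpace ℂ L] [CompleteSpace L]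
    {σ : B →⋆ₐ[ℂ] (L →L[ℂ] L)} {d : L} (hd : σ (ι t) d = d) (hd1 : ‖d‖ = 1)
    {e : H} (hc : IsCyclicVector π e) (he : π t e = e) {x : H} (hx : ‖x‖ = 1) :
    ∃! Ω : B →ₗ[ℂ] ℂ, Ω ∈ states B ∧ ∀ a, Ω (ι a) = vectorState π x a := by
  have hσd : vectorState (σ.comp ι) ((‖e‖ : ℂ) • d) = vectorState π e :=
    ht.vectorState_eq (by rw [map_smul, StarAlgHom.comp_apply, hd]) he (by simp [norm_smul, hd1])
  obtain ⟨W, hW, _, hWπ⟩ := exists_intertwiner_of_vectorState_eq hc hσd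
  have hWx : ‖W x‖ = 1 := (norm_eq_of_vectorState_eq (hWπ x)).trans hx
  refine ⟨vectorState σ (W x), ⟨vectorState_mem_states σ hWx, fun a =>
    congrArg (fun φ : A →ₗ[ℂ] ℂ => φ a) (hWπ x)⟩, fun Ω hΩ => ?_⟩
  obtain ⟨hΩ, hΩι⟩ := hΩ
  obtain ⟨K, _, _, _, ρ, ξ, rfl⟩ := exists_vectorState_eq hΩ.1
  have hx0 : x ≠ 0 := norm_ne_zero_iff.1 (by simp [hx])
  obtain ⟨V, hV, rfl, hVπ⟩ := exists_intertwiner_of_vectorState_eq (ρ := ρ.comp ι)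
    ((ht.hasTrivialCommutant hc he).isCyclicVector hx0) (LinearMap.ext hΩι)
  refine vectorState_map_eq_of_isCyclicVector ι hV hW hc ?_ x
  exact hιt.vectorState_eq (hV.map_fixed he) (hW.map_fixed he)
    ((norm_eq_of_vectorState_eq (hVπ e)).trans (norm_eq_of_vectorState_eq (hWπ e)).symm)

end FixedFunctionals

/-- The subspace `span D + A (t - 1)`. A functional with `φ(a t) = φ(a)` vanishes on it as soon as
it vanishes on `D`. -/
noncomputable def spanAddLeftIdeal {A : Type*} [Ring A] [Algebra ℂ A] (t : A) (D : Set A) :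
    Submodule ℂ A :=
  Submodule.span ℂ D ⊔ (Ideal.span {t - 1}).restrictScalars ℂ

namespace spanAddLeftIdeal

variable {A : Type*} [Ring A] [Algebra ℂ A] {t : A} {D : Set A}

theorem subset : D ⊆ spanAddLeftIdeal t D :=
  Submodule.subset_span.trans (le_sup_left : _ ≤ spanAddLeftIdeal t D)

theorem mul_mem_iff {a : A} : a * t ∈ spanAddLeftIdeal t D ↔ a ∈ spanAddLeftIdeal t D := by
  have h : a * t - a ∈ spanAddLeftIdeal t D :=
    (le_sup_right : _ ≤ spanAddLeftIdeal t D)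
      (Ideal.mem_span_singleton'.2 ⟨a, by rw [mul_sub, mul_one]⟩)
  exact ⟨fun ha => by simpa using sub_mem ha h, fun ha => by simpa using add_mem ha h⟩

theorem mul_left_mem {b : A} (hb : ∀ d ∈ D, b * d ∈ spanAddLeftIdeal t D) {a : A}
    (ha : a ∈ spanAddLeftIdeal t D) : b * a ∈ spanAddLeftIdeal t D := by
  suffices spanAddLeftIdeal t D ≤ (spanAddLeftIdeal t D).comap (LinearMap.mulLeft ℂ b) from this ha
  refine sup_le (Submodule.span_le.2 hb) fun a ha => ?_
  exact (le_sup_right : _ ≤ spanAddLeftIdeal t D) (Ideal.mul_mem_left _ b ha)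

theorem map_eq_zero {φ : A →ₗ[ℂ] ℂ} (hφ : ∀ a, φ (a * t) = φ a) (hD : ∀ d ∈ D, φ d = 0) {a : A}
    (ha : a ∈ spanAddLeftIdeal t D) : φ a = 0 := by
  suffices spanAddLeftIdeal t D ≤ LinearMap.ker φ from this ha
  refine sup_le (Submodule.span_le.2 hD) fun a ha => ?_
  obtain ⟨b, rfl⟩ := Ideal.mem_span_singleton'.1 ha
  simp [mul_sub, hφ]

end spanAddLeftIdeal

/-! ### Universal C*-algebras -/

namespace UnivCStar

variable {X : Type} {R : Set (FreeStarAlg X)}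

theorem mkHom_eq_mkHom {a b : FreeStarAlg X} (h : a - b ∈ R) : mkHom R a = mkHom R b := by
  rw [← sub_eq_zero, ← map_sub]
  exact mkHom_eq_zero h

theorem dense_of_one_mem_of_mul_mem {N : Submodule ℂ (UnivCStar R)} (one_mem : 1 ∈ N)
    (gen_mul_mem : ∀ x, ∀ a ∈ N, gen R x * a ∈ N)
    (star_gen_mul_mem : ∀ x, ∀ a ∈ N, star (gen R x) * a ∈ N) :
    Dense (N : Set (UnivCStar R)) := by
  have hN : ∀ b, ∀ a ∈ N.topologicalClosure, b * a ∈ N.topologicalClosure := by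
    have closure_invariant {b : UnivCStar R} (hb : ∀ a ∈ N, b * a ∈ N) :
        ∀ a ∈ N.topologicalClosure, b * a ∈ N.topologicalClosure :=
      Submodule.topologicalClosure_mem_invtSubmodule (f := ContinuousLinearMap.mul ℂ _ b) hb
    intro b
    induction b using induct_gen with
    | hc =>
      simp only [Set.ofPred_forall]
      exact isClosed_iInter fun a => isClosed_iInter fun _ =>
        N.isClosed_topologicalClosure.preimage (continuous_mul_const a)
    | h₀ c =>
      intro a ha
      rw [← Algebra.smul_def]
      exact Submodule.smul_mem _ c ha
    | h₁ x => exact closure_invariant (gen_mul_mem x)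
    | h₂ x => exact closure_invariant (star_gen_mul_mem x)
    | hm b b' hb hb' => exact fun a ha => by rw [mul_assoc]; exact hb _ (hb' a ha)
    | ha b b' hb hb' => exact fun a ha => by rw [add_mul]; exact add_mem (hb a ha) (hb' a ha)
  intro b
  have := hN b 1 (N.le_topologicalClosure one_mem)
  rwa [mul_one] at this

theorem hasUniqueFixedFunctional {t : UnivCStar R} {D : Set (UnivCStar R)} (one_mem : 1 ∈ D)
    (gen_mul_mem : ∀ x, ∀ d ∈ D, gen R x * d ∈ spanAddLeftIdeal t D)
    (star_gen_mul_mem : ∀ x, ∀ d ∈ D, star (gen R x) * d ∈ spanAddLeftIdeal t D)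
    (map_eq_zero : ∀ φ : UnivCStar R →L[ℂ] ℂ, (∀ a, φ (a * t) = φ a) →
      (∀ a, φ (star t * a) = φ a) → φ 1 = 0 → ∀ d ∈ D, φ d = 0) :
    HasUniqueFixedFunctional t := by
  intro φ hr hl h1
  have hdense := dense_of_one_mem_of_mul_mem (spanAddLeftIdeal.subset one_mem)
    (fun x _ => spanAddLeftIdeal.mul_left_mem (gen_mul_mem x))
    (fun x _ => spanAddLeftIdeal.mul_left_mem (star_gen_mul_mem x))
  exact ContinuousLinearMap.coeFn_injective <| φ.continuous.ext_on hdense continuous_const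
    fun _ => spanAddLeftIdeal.map_eq_zero (φ := φ.toLinearMap) hr (map_eq_zero φ hr hl h1)

end UnivCStar

theorem star_mul_eq_zero_of_add_eq_one {B : Type*} [Ring B] [StarRing B] {a b : B}
    (ha : star a * a = 1) (hb : star b * b = 1) (h : a * star a + b * star b = 1) :
    star a * b = 0 := by
  have : star a * b + star a * b = star a * b := calc
    star a * b + star a * b = star a * a * (star a * b) + star a * b * (star b * b) := by
      rw [ha, hb, one_mul, mul_one]
    _ = star a * (a * star a + b * star b) * b := by noncomm_ring
    _ = star a * b := by rw [h, mul_one]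
  exact add_eq_left.1 this

/-! ### The Cuntz algebra -/

namespace CuntzO2

theorem star_S_mul_S (j : CuntzGen) : star (S j) * S j = 1 := by
  simpa only [S, UnivCStar.gen, map_mul, map_star, map_one] using
    UnivCStar.mkHom_eq_mkHom (R := cuntzRelations)
      (a := star (FreeStarAlg.gen j) * FreeStarAlg.gen j) (b := 1)
      (by cases j <;> simp [cuntzRelations])

theorem range_sum : S .s1 * star (S .s1) + S .s2 * star (S .s2) = 1 := by
  simpa only [S, UnivCStar.gen, map_add, map_mul, map_star, map_one] using
    UnivCStar.mkHom_eq_mkHom (R := cuntzRelations)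
      (a := FreeStarAlg.gen CuntzGen.s1 * star (FreeStarAlg.gen CuntzGen.s1) +
        FreeStarAlg.gen CuntzGen.s2 * star (FreeStarAlg.gen CuntzGen.s2)) (b := 1)
      (by simp [cuntzRelations])

theorem star_S_mul_S_of_ne {j k : CuntzGen} (h : j ≠ k) : star (S j) * S k = 0 := by
  cases j <;> cases k
  · exact absurd rfl h
  · exact star_mul_eq_zero_of_add_eq_one (star_S_mul_S _) (star_S_mul_S _) range_sum
  · exact star_mul_eq_zero_of_add_eq_one (star_S_mul_S _) (star_S_mul_S _)
      ((add_comm _ _).trans range_sum)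
  · exact absurd rfl h

/-- The product of the generators along a word. -/
noncomputable def word (l : List CuntzGen) : CuntzO2 := (l.map S).prod

theorem word_nil : word [] = 1 := rfl

theorem word_cons (j : CuntzGen) (l : List CuntzGen) : word (j :: l) = S j * word l :=
  List.prod_cons

theorem star_S_mul_word_cons (j k : CuntzGen) (l : List CuntzGen) :
    star (S j) * word (k :: l) = word l ∨ star (S j) * word (k :: l) = 0 := by
  rw [word_cons, ← mul_assoc]
  obtain rfl | h := eq_or_ne j k
  · exact .inl (by rw [star_S_mul_S, one_mul])
  · exact .inr (by rw [star_S_mul_S_of_ne h, zero_mul])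

theorem hasUniqueFixedFunctional_S (i : CuntzGen) : HasUniqueFixedFunctional (S i) := by
  refine UnivCStar.hasUniqueFixedFunctional (D := Set.range word) ⟨[], word_nil⟩ ?_ ?_ ?_
  · rintro j _ ⟨l, rfl⟩
    exact spanAddLeftIdeal.subset ⟨j :: l, word_cons j l⟩
  · have cons_mem (j k : CuntzGen) (l : List CuntzGen) :
        star (S j) * word (k :: l) ∈ spanAddLeftIdeal (S i) (Set.range word) := by
      obtain h | h := star_S_mul_word_cons j k l
      · exact h ▸ spanAddLeftIdeal.subset ⟨l, rfl⟩
      · exact h ▸ zero_mem _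
    rintro j _ ⟨_ | ⟨k, l⟩, rfl⟩
    · have := cons_mem j i []
      rwa [word_cons, word_nil, mul_one, spanAddLeftIdeal.mul_mem_iff,
        ← mul_one (star (S j))] at this
    · exact cons_mem j k l
  · rintro φ - hφ h1 _ ⟨l, rfl⟩
    induction l with
    | nil => exact h1
    | cons j l ih =>
      rw [← hφ]
      obtain h | h := star_S_mul_word_cons i j l
      · rw [h, ih]
      · rw [h, map_zero]

end CuntzO2

/-- The exponent `d` with `S_i ↦ U ^ d S₂` under `O₂ ⊂ Q₂`; it is the binary digit that
`S_i e_k = e_{2k + d}` appends to `k`. -/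
def digit : CuntzGen → ℤ
  | .s1 => 1
  | .s2 => 0

/-! ### The 2-adic ring C*-algebra -/

namespace TwoAdicQ2

theorem U_mul_star_U : U * star U = 1 := by
  simpa only [U, UnivCStar.gen, map_mul, map_star, map_one] using
    relation_eq (a := FreeStarAlg.gen TwoAdicGen.u * star (FreeStarAlg.gen TwoAdicGen.u)) (b := 1)
      (by simp [twoAdicRelations])

theorem S₂_mul_U : S₂ * U = U ^ 2 * S₂ := by
  have := relation_eq (a := FreeStarAlg.gen TwoAdicGen.s * FreeStarAlg.gen TwoAdicGen.u)
    (b := FreeStarAlg.gen TwoAdicGen.u ^ 2 * FreeStarAlg.gen TwoAdicGen.s)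
    (by simp [twoAdicRelations])
  rwa [map_mul, map_mul, map_pow] at this

theorem star_S₂_mul_U_mul_S₂ : star S₂ * (U * S₂) = 0 := by
  refine star_mul_eq_zero_of_add_eq_one star_S₂_mul_S₂ ?_ ?_
  · rw [star_mul, mul_assoc, ← mul_assoc (star U), star_U_mul_U, one_mul, star_S₂_mul_S₂]
  · rw [star_mul, ← mul_assoc, range_sum]

/-- The unitary `U` as a unit, so that it has integer powers. -/
noncomputable def unitU : TwoAdicQ2ˣ := ⟨U, star U, U_mul_star_U, star_U_mul_U⟩

/-- The integer power `U ^ k`. -/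
noncomputable def powU (k : ℤ) : TwoAdicQ2 := (unitU ^ k : TwoAdicQ2ˣ)

theorem powU_zero : powU 0 = 1 := by simp [powU]

theorem powU_one : powU 1 = U := by simp [powU, unitU]

theorem powU_add (k l : ℤ) : powU (k + l) = powU k * powU l := by simp [powU, zpow_add]

theorem star_powU (k : ℤ) : star (powU k) = powU (-k) := by
  have : star unitU = unitU⁻¹ := Units.ext rfl
  rw [powU, ← Units.coe_star, star_zpow, this, inv_zpow', powU]

theorem S₂_mul_powU (k : ℤ) : S₂ * powU k = powU (2 * k) * S₂ := by
  have : SemiconjBy S₂ (unitU : TwoAdicQ2) (unitU ^ 2 : TwoAdicQ2ˣ) := S₂_mul_U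
  rw [powU, powU, zpow_mul]
  exact this.units_zpow_right k

theorem star_S₂_mul_powU_even_mul_S₂ (k : ℤ) : star S₂ * (powU (2 * k) * S₂) = powU k := by
  rw [← S₂_mul_powU, ← mul_assoc, star_S₂_mul_S₂, one_mul]

theorem star_S₂_mul_powU_odd_mul_S₂ (k : ℤ) : star S₂ * (powU (2 * k + 1) * S₂) = 0 := by
  rw [add_comm, powU_add, mul_assoc, ← S₂_mul_powU, powU_one, ← mul_assoc U, ← mul_assoc,
    star_S₂_mul_U_mul_S₂, zero_mul]

theorem cuntzInclusion_S (i : CuntzGen) : cuntzInclusion (CuntzO2.S i) = powU (digit i) * S₂ := by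
  cases i
  · rw [cuntzInclusion_s1, digit, powU_one]
  · rw [cuntzInclusion_s2, digit, powU_zero, one_mul]

theorem star_powU_mul_S₂_mul_powU_mul (d k : ℤ) :
    star (powU d * S₂) * (powU k * (powU d * S₂)) = star S₂ * (powU k * S₂) := by
  have hk : -d + (k + d) = k := by ring
  rw [star_mul, star_powU, mul_assoc, ← mul_assoc (powU k), ← powU_add, ← mul_assoc (powU (-d)),
    ← powU_add, hk]

theorem map_powU_eq_zero {φ : TwoAdicQ2 →ₗ[ℂ] ℂ}
    (hφ : ∀ k, φ (powU k) = φ (star S₂ * (powU k * S₂))) (h1 : φ 1 = 0) (k : ℤ) :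
    φ (powU k) = 0 := by
  induction hn : k.natAbs using Nat.strong_induction_on generalizing k with
  | _ n ih =>
    rw [hφ]
    obtain ⟨m, rfl | rfl⟩ := Int.even_or_odd' k
    · rw [star_S₂_mul_powU_even_mul_S₂]
      obtain rfl | hm := eq_or_ne m 0
      · rw [powU_zero, h1]
      · exact ih _ (by omega) m rfl
    · rw [star_S₂_mul_powU_odd_mul_S₂, map_zero]

theorem hasUniqueFixedFunctional_powU_mul_S₂ (d : ℤ) : HasUniqueFixedFunctional (powU d * S₂) := by
  refine UnivCStar.hasUniqueFixedFunctional (D := Set.range powU) ⟨0, powU_zero⟩ ?_ ?_ ?_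
  · rintro (_ | _) _ ⟨k, rfl⟩
    · exact spanAddLeftIdeal.subset ⟨1 + k, by rw [powU_add, powU_one]; rfl⟩
    · change S₂ * powU k ∈ _
      have : S₂ * powU k = powU (2 * k - d) * (powU d * S₂) := by
        rw [← mul_assoc, ← powU_add, sub_add_cancel, S₂_mul_powU]
      rw [this, spanAddLeftIdeal.mul_mem_iff]
      exact spanAddLeftIdeal.subset ⟨_, rfl⟩
  · rintro (_ | _) _ ⟨k, rfl⟩
    · exact spanAddLeftIdeal.subset ⟨-1 + k, by rw [powU_add, ← star_powU, powU_one]; rfl⟩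
    · change star S₂ * powU k ∈ _
      rw [← spanAddLeftIdeal.mul_mem_iff, mul_assoc, ← mul_assoc (powU k), ← powU_add]
      obtain ⟨m, hm | hm⟩ := Int.even_or_odd' (k + d)
      · rw [hm, star_S₂_mul_powU_even_mul_S₂]
        exact spanAddLeftIdeal.subset ⟨m, rfl⟩
      · rw [hm, star_S₂_mul_powU_odd_mul_S₂]
        exact zero_mem _
  · rintro φ hr hl h1 _ ⟨k, rfl⟩
    refine map_powU_eq_zero (φ := φ.toLinearMap) (fun k => ?_) h1 k
    calc φ (powU k)
      _ = φ (star (powU d * S₂) * (powU k * (powU d * S₂))) := by rw [hl, hr]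
      _ = φ (star S₂ * (powU k * S₂)) := by rw [star_powU_mul_S₂_mul_powU_mul]

end TwoAdicQ2

/-! ### The canonical representation -/

theorem norm_stdBasis (k : ℤ) : ‖stdBasis k‖ = 1 := by
  simp [stdBasis]

theorem cuntzCanonicalRep_S_stdBasis (j : CuntzGen) (k : ℤ) :
    cuntzCanonicalRep (CuntzO2.S j) (stdBasis k) = stdBasis (2 * k + digit j) := by
  cases j
  · rw [cuntzCanonicalRep_s1, mul_apply_eq_comp, doubleZ_apply, shiftZ_apply, digit]
  · rw [cuntzCanonicalRep_s2, doubleZ_apply, digit, add_zero]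

theorem cuntzCanonicalRep_S_stdBasis_neg_digit (i : CuntzGen) :
    cuntzCanonicalRep (CuntzO2.S i) (stdBasis (-digit i)) = stdBasis (-digit i) := by
  rw [cuntzCanonicalRep_S_stdBasis, two_mul, neg_add_cancel_right]

theorem exists_hilbertBasis_basisSpan {s : Set ℤ} {b : ℕ → ℤ} (hb : Function.Injective b)
    (hs : Set.range b = s) :
    ∃ e : HilbertBasis ℕ ℂ (basisSpan s), ∀ n, (e n : L2Z) = stdBasis (b n) := by
  have hbs (n : ℕ) : b n ∈ s := hs ▸ ⟨n, rfl⟩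
  let v (n : ℕ) : basisSpan s := ⟨stdBasis (b n), stdBasis_mem (hbs n)⟩
  have hv : Orthonormal ℂ v := orthonormal_iff_ite.2 fun m n =>
    (inner_stdBasis (b m) (b n)).trans (by simp only [hb.eq_iff])
  refine ⟨HilbertBasis.mkOfOrthogonalEqBot hv (Submodule.eq_bot_iff _ |>.2 fun y hy => ?_),
    fun n => by rw [HilbertBasis.coe_mkOfOrthogonalEqBot]⟩
  have hspan : Submodule.span ℂ (stdBasis '' s) ≤ (ℂ ∙ (y : L2Z))ᗮ := by
    rw [Submodule.span_le]
    rintro _ ⟨k, hk, rfl⟩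
    obtain ⟨n, rfl⟩ : k ∈ Set.range b := hs ▸ hk
    rw [SetLike.mem_coe, Submodule.mem_orthogonal_singleton_iff_inner_left]
    exact hy (v n) (Submodule.subset_span ⟨n, rfl⟩)
  have hy_self := Submodule.topologicalClosure_minimal _ hspan
    (Submodule.isClosed_orthogonal _) y.2
  rw [Submodule.mem_orthogonal_singleton_iff_inner_left, inner_self_eq_zero] at hy_self
  exact Subtype.ext hy_self

/-! ### Representations of type `P(i)` -/

/-- The branching function system on `ℕ` in which `branch i i n = 2 n`, the other function being
`n ↦ 2 n + 1`; thus `0` is the fixed point of `branch i i`. -/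
def branch : CuntzGen → CuntzGen → ℕ → ℕ
  | .s1, .s1, n | .s2, .s2, n => 2 * n
  | .s1, .s2, n | .s2, .s1, n => 2 * n + 1

theorem branch_injective (i j : CuntzGen) : Function.Injective (branch i j) := by
  intro m n
  cases i <;> cases j <;> simp only [branch] <;> omega

theorem isCompl_range_branch (i : CuntzGen) :
    IsCompl (Set.range (branch i .s1)) (Set.range (branch i .s2)) := by
  have h : IsCompl (Set.range fun n : ℕ => 2 * n) (Set.range fun n : ℕ => 2 * n + 1) := by
    rw [range_two_mul, range_two_mul_add_one]
    exact Nat.isCompl_even_odd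
  cases i
  · exact h
  · exact h.symm

theorem branch_self_zero (i : CuntzGen) : branch i i 0 = 0 := by
  cases i <;> rfl

theorem exists_branch_eq_of_ne_zero (i : CuntzGen) {n : ℕ} (hn : n ≠ 0) :
    ∃ j, ∃ m < n, branch i j m = n := by
  obtain ⟨m, rfl | rfl⟩ := Nat.even_or_odd' n
  · exact ⟨i, m, by omega, by cases i <;> rfl⟩
  · cases i
    · exact ⟨.s2, m, by omega, rfl⟩
    · exact ⟨.s1, m, by omega, rfl⟩

section TypeP

variable {H : Type*} [NormedAddCommGroup H] [InnerProductSpace ℂ H] [CompleteSpace H]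
  {π : CuntzO2 →⋆ₐ[ℂ] (H →L[ℂ] H)} {i : CuntzGen} {e : HilbertBasis ℕ ℂ H}

theorem isCyclicVector_of_branch (he : ∀ j n, π (CuntzO2.S j) (e n) = e (branch i j n)) :
    IsCyclicVector π (e 0) := by
  let orbit : Submodule ℂ H := LinearMap.range
    ((ContinuousLinearMap.apply ℂ H (e 0)).toLinearMap ∘ₗ π.toAlgHom.toLinearMap)
  have hmem (n : ℕ) : e n ∈ orbit := by
    induction n using Nat.strong_induction_on with
    | _ n ih =>
      obtain rfl | hn := eq_or_ne n 0
      · exact ⟨1, by simp⟩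
      · obtain ⟨j, m, hm, rfl⟩ := exists_branch_eq_of_ne_zero i hn
        obtain ⟨a, ha⟩ := ih m hm
        refine ⟨CuntzO2.S j * a, ?_⟩
        rw [← he, ← ha]
        exact congrArg (fun T : H →L[ℂ] H => T (e 0)) (map_mul π _ a)
  have hspan : Submodule.span ℂ (Set.range e) ≤ orbit :=
    Submodule.span_le.2 (Set.range_subset_iff.2 hmem)
  exact ((Submodule.dense_iff_topologicalClosure_eq_top).2 e.dense_span).mono hspan

theorem isOfTypeP_of_branch (he : ∀ j n, π (CuntzO2.S j) (e n) = e (branch i j n)) :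
    IsOfTypeP i π :=
  ⟨e, branch i, branch_injective i, isCompl_range_branch i, he, 0,
    by rw [he, branch_self_zero], isCyclicVector_of_branch he⟩

end TypeP

theorem isOfTypeP_of_coe_apply_eq {s : Set ℤ}
    {π : CuntzO2 →⋆ₐ[ℂ] (basisSpan s →L[ℂ] basisSpan s)}
    (hπ : ∀ a v, (π a v : L2Z) = cuntzCanonicalRep a v) {i : CuntzGen} {b : ℕ → ℤ}
    (hb : Function.Injective b) (hs : Set.range b = s)
    (hbranch : ∀ j n, b (branch i j n) = 2 * b n + digit j) : IsOfTypeP i π := by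
  obtain ⟨e, he⟩ := exists_hilbertBasis_basisSpan hb hs
  refine isOfTypeP_of_branch (e := e) fun j n => Subtype.ext ?_
  rw [hπ, he, he, cuntzCanonicalRep_S_stdBasis, hbranch]

theorem isOfTypeP_piPlus : IsOfTypeP .s2 piPlus := by
  refine isOfTypeP_of_coe_apply_eq (fun _ _ => rfl) (b := fun n => n) Nat.cast_injective ?_ ?_
  · refine Set.ext fun k => ⟨?_, fun hk => ⟨k.toNat, Int.toNat_of_nonneg hk⟩⟩
    rintro ⟨n, rfl⟩
    exact Int.natCast_nonneg n
  · rintro (_ | _) n <;> simp [branch, digit]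

theorem isOfTypeP_piMinus : IsOfTypeP .s1 piMinus := by
  refine isOfTypeP_of_coe_apply_eq (fun _ _ => rfl) (b := Int.negSucc)
    (fun _ _ => Int.negSucc.inj) ?_ ?_
  · refine Set.ext fun k => ⟨?_, fun hk => (Int.eq_negSucc_of_lt_zero hk).imp fun _ => Eq.symm⟩
    rintro ⟨n, rfl⟩
    exact Int.negSucc_lt_zero n
  · rintro (_ | _) n <;> simp only [branch, digit, Int.negSucc_eq] <;> push_cast <;> ring

theorem mainTheorem7_general :
    IsOfTypeP .s1 piMinus ∧ IsOfTypeP .s2 piPlus ∧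
    ∀ {H : Type*} [NormedAddCommGroup H] [InnerProductSpace ℂ H] [CompleteSpace H]
      (i : CuntzGen) (π : CuntzO2 →⋆ₐ[ℂ] (H →L[ℂ] H)) (e : H), π (CuntzO2.S i) e = e →
      IsCyclicVector π e → ∀ x : H, ‖x‖ = 1 →
        vectorState π x ∈ pureStates CuntzO2 ∧
        ∃! Ω : TwoAdicQ2 →ₗ[ℂ] ℂ, Ω ∈ states TwoAdicQ2 ∧
          ∀ T, Ω (cuntzInclusion T) = vectorState π x T := by
  refine ⟨isOfTypeP_piMinus, isOfTypeP_piPlus, fun i π e he hc x hx => ?_⟩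
  have hS := CuntzO2.hasUniqueFixedFunctional_S i
  have hιS : HasUniqueFixedFunctional (cuntzInclusion (CuntzO2.S i)) := by
    rw [TwoAdicQ2.cuntzInclusion_S]
    exact TwoAdicQ2.hasUniqueFixedFunctional_powU_mul_S₂ _
  exact ⟨(hS.hasTrivialCommutant hc he).vectorState_mem_pureStates hx,
    existsUnique_state_extension cuntzInclusion hS hιS (σ := canonicalRep)
      (cuntzCanonicalRep_S_stdBasis_neg_digit i) (norm_stdBasis _) hc he hx⟩

theorem mainTheorem7 :
    IsOfTypeP .s1 piMinus ∧ IsOfTypeP .s2 piPlus ∧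
    ∀ {H : Type*} [NormedAddCommGroup H] [InnerProductSpace ℂ H] [CompleteSpace H]
      (i : CuntzGen) (π : CuntzO2 →⋆ₐ[ℂ] (H →L[ℂ] H)), IsOfTypeP i π →
      ∀ x : H, ‖x‖ = 1 →
        vectorState π x ∈ pureStates CuntzO2 ∧ HasUniquePureExtension (vectorState π x) := by
  obtain ⟨hMinus, hPlus, hcyclic⟩ := mainTheorem7_general
  refine ⟨hMinus, hPlus, fun i π ⟨e, _, _, _, _, n, he, hc⟩ x hx => ?_⟩
  obtain ⟨hpure, hext⟩ := hcyclic i π (e n) he hc x hx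
  exact ⟨hpure, existsUnique_pure_extension cuntzInclusion hpure hext⟩
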